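/- **Conventions.** A composition $I=i_1\dotsm i_s\vDash n$ is a finite sequence of positive integers with sum $|I|=n$; the empty composition is the only composition of $0$. Write $\overline I$ for the reversal of $I$, and $I\!J$ for the concatenation of $I$ and $J$. Put $w_I=i_1\prod_{j\ge2}(i_j-1)$ and $e_I=e_{i_1}e_{i_2}\dotsm$, where $e_k$ is the elementary symmetric function in the variables $x_1,x_2,\dots$. For $0\le c\le|I|$ let $$\sigma_I^+(c)=\min\{i_1+\dots+i_k\colon 0\le k\le s,\ i_1+\dots+i_k\ge c\},\qquad \Theta_I^+(c)=\sigma_I^+(c)-c,$$ $$\sigma_I^-(c)=\max\{i_1+\dots+i_k\colon 0\le k\le s,\ i_1+\dots+i_k\le c\},\qquad \Theta_I^-(c)=c-\sigma_I^-(c).$$ The chromatic symmetric function of a finite graph $G$ is $X_G=\sum_\kappa\prod_{v\in V(G)}x_{\kappa(v)}$, where $\kappa$ runs over all proper colorings of $G$ by positive integers. **Theorem (Hats).** Let $n=a+m+b$, where $m\ge2$ and $a,b\ge0$, and let the hat $H_{a,m,b}$ be the graph obtained from the path $v_1v_2\dotsm v_n$ by adding the edge $v_{a+1}v_{a+m}$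 (a repeated edge if $m=2$). For $K\vDash n$ let $N_K=\Theta_K^+(b+1)-\Theta_K^+(b+m)$. For a composition $J$ with $|J|\ge b+1$, let $J=J_1J_2$ be the bisection with $|J_1|=\sigma_J^+(b+1)$. Then $$X_{H_{a,m,b}}=\sum_{K\vDash n,\ N_K\le-1}\frac{-N_K\,w_K\,e_K}{\Theta_K^+(b+m)+\Theta_K^-(b+m-1)}+\sum_{K\vDash n,\ N_K\ge1}N_K\,w_K\,e_K+\sum_{(I,J)\in\mathcal S_{a,m,b}}(m-1-|I|)\,w_I\,w_J\,e_{I\!J},$$ where $\mathcal S_{a,m,b}$ is the set of pairs $(I,J)$ of compositions given by \begin{align*} \mathcal S_{a,m,b}=\ &\{(I,J)\colon K=J_1\overline IJ_2\vDash n,\ i_1\ne1,\ |J_1|\le b+m-1,\ 2\le|I|\le m-2,\ |J_2|\le\sigma_{\overline K}^-(a)-1\}\\ \cup\ &\{(I,J)\colon J_1\overline IJ_2\vDash n,\ i_1\ne1,\ |J_1|\ge b+m,\ 2\le|I|\le m-2\}\\ \cup\ &\{(I,J)\colon I\!J\vDash n,\ i_1=1,\ |I|\le m-2,\ |J_2|\le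 a-1\}. \end{align*} Moreover, this expansion is positive: all the coefficients $\frac{-N_Kw_K}{\Theta_K^+(b+m)+\Theta_K^-(b+m-1)}$, $N_Kw_K$ and $(m-1-|I|)w_Iw_J$ occurring in the three sums are nonnegative. -/

import Mathlib

namespace ChromaticHat

/-! ### Symmetric functions, as formal power series over `ℚ` in `x₀, x₁, x₂, …` -/

/-- The chromatic symmetric function `X_G = ∑_κ ∏_v x_{κ(v)}`, where `κ` runs over the proper
colorings of the finite graph `G` with colors in `ℕ`: the coefficient of the monomial `x ^ d` is
the number of proper colorings `κ` with `∏_v x_{κ(v)} = x ^ d`. -/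
noncomputable def chromaticSymm {V : Type*} [Fintype V] (G : SimpleGraph V) :
    MvPowerSeries ℕ ℚ :=
  fun d => (Nat.card {κ : G.Coloring ℕ // ∑ v, Finsupp.single (κ v) 1 = d} : ℚ)

/-- The set of colorings counted in a coefficient of `X_G` is finite. -/
theorem finite_colorings {V : Type*} [Fintype V] (G : SimpleGraph V) (d : ℕ →₀ ℕ) :
    Finite {κ : G.Coloring ℕ // ∑ v, Finsupp.single (κ v) 1 = d} := by
  have hmem : ∀ (κ : {κ : G.Coloring ℕ // ∑ v, Finsupp.single (κ v) 1 = d}) (v : V),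
      κ.1 v ∈ d.support := by
    rintro ⟨κ, rfl⟩ v
    rw [Finsupp.mem_support_iff, Finsupp.finsetSum_apply]
    have h : Finsupp.single (κ v) 1 (κ v) ≤ ∑ u, Finsupp.single (κ u) 1 (κ v) :=
      Finset.single_le_sum (f := fun u => Finsupp.single (κ u) 1 (κ v))
        (fun _ _ => Nat.zero_le _) (Finset.mem_univ v)
    rw [Finsupp.single_eq_same] at h
    exact Nat.one_le_iff_ne_zero.mp h
  refine Finite.of_injective (β := V → d.support) (fun κ v => ⟨κ.1 v, hmem κ v⟩) ?_
  intro κ κ' h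
  apply Subtype.ext
  apply RelHom.ext
  intro v
  exact congrArg Subtype.val (congrFun h v)

/-- The elementary symmetric function `e_k`, the sum of all squarefree monomials of degree `k`. -/
noncomputable def elem (k : ℕ) : MvPowerSeries ℕ ℚ :=
  open Classical in
  fun d => if d.degree = k ∧ ∀ i, d i ≤ 1 then 1 else 0

/-- `e_I = e_{i₁} e_{i₂} ⋯` for a sequence `I = i₁ i₂ ⋯`. -/
noncomputable def elemComp (I : List ℕ) : MvPowerSeries ℕ ℚ := (I.map elem).prod

/-! ### Compositions and functions on them -/

/-- `I ⊨ n`: `I` is a sequence of positive integers with sum `n`. -/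
def IsComp (I : List ℕ) (n : ℕ) : Prop := (∀ i ∈ I, 0 < i) ∧ I.sum = n

/-- `w_I = i₁ (i₂ - 1) (i₃ - 1) ⋯`, and `1` for the empty composition. -/
def weight : List ℕ → ℚ
  | [] => 1
  | i :: I => (i : ℚ) * (I.map fun j => (j : ℚ) - 1).prod

/-- The surplus partial sum `σ⁺_I(a)`, for `a ≤ |I|`: the least partial sum `i₁ + ⋯ + i_k`,
`0 ≤ k ≤ ℓ(I)`, that is at least `a`. -/
noncomputable def sigmaPlus (I : List ℕ) (a : ℕ) : ℕ :=
  sInf {s | ∃ k ≤ I.length, s = (I.take k).sum ∧ a ≤ s}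

/-- The deficiency partial sum `σ⁻_I(a)`: the greatest partial sum `i₁ + ⋯ + i_k`,
`0 ≤ k ≤ ℓ(I)`, that is at most `a`. -/
noncomputable def sigmaMinus (I : List ℕ) (a : ℕ) : ℕ :=
  sSup {s | ∃ k ≤ I.length, s = (I.take k).sum ∧ s ≤ a}

/-- The `a`-surplus `Θ⁺_I(a) = σ⁺_I(a) - a`. -/
noncomputable def thetaPlus (I : List ℕ) (a : ℕ) : ℤ := (sigmaPlus I a : ℤ) - a

/-- The `a`-deficiency `Θ⁻_I(a) = a - σ⁻_I(a)`. -/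
noncomputable def thetaMinus (I : List ℕ) (a : ℕ) : ℤ := (a : ℤ) - sigmaMinus I a

/-! ### Hats -/

/-- The hat `H_{a,m,b}`: the path `v₁ ⋯ v_n` on `n = a + m + b` vertices with the additional edge
`v_{a+1} v_{a+m}`. The vertex `v_i` is the element `i - 1` of `Fin n`. For `m = 2` the additional
edge is parallel to an edge of the path, which does not affect proper colorings. -/
def hat (a m b : ℕ) (hm : 2 ≤ m) : SimpleGraph (Fin (a + m + b)) :=
  SimpleGraph.pathGraph (a + m + b) ⊔
    SimpleGraph.edge ⟨a, by omega⟩ ⟨a + m - 1, by omega⟩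

/-- `N_K = Θ⁺_K(b+1) - Θ⁺_K(b+m)`. -/
noncomputable def hatN (m b : ℕ) (K : List ℕ) : ℤ :=
  thetaPlus K (b + 1) - thetaPlus K (b + m)

/-- `J = J₁ J₂` is the bisection of `J` with `|J₁| = σ⁺_J(b+1)`. -/
def IsBisection (b : ℕ) (J J₁ J₂ : List ℕ) : Prop :=
  J = J₁ ++ J₂ ∧ J₁.sum = sigmaPlus J (b + 1)

/-- The set `S_{a,m,b}` of pairs of compositions, as a union of three sets. -/
def hatSet (a m b : ℕ) : Set (List ℕ × List ℕ) :=
  {p | ∃ I J J₁ J₂ K, p = (I, J) ∧ IsBisection b J J₁ J₂ ∧ K = J₁ ++ I.reverse ++ J₂ ∧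
      IsComp K (a + m + b) ∧ I.head? ≠ some 1 ∧ J₁.sum ≤ b + m - 1 ∧
      2 ≤ I.sum ∧ (I.sum : ℤ) ≤ (m : ℤ) - 2 ∧
      (J₂.sum : ℤ) ≤ (sigmaMinus K.reverse a : ℤ) - 1} ∪
  {p | ∃ I J J₁ J₂ K, p = (I, J) ∧ IsBisection b J J₁ J₂ ∧ K = J₁ ++ I.reverse ++ J₂ ∧
      IsComp K (a + m + b) ∧ I.head? ≠ some 1 ∧ b + m ≤ J₁.sum ∧
      2 ≤ I.sum ∧ (I.sum : ℤ) ≤ (m : ℤ) - 2} ∪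
  {p | ∃ I J J₁ J₂, p = (I, J) ∧ IsBisection b J J₁ J₂ ∧
      IsComp (I ++ J) (a + m + b) ∧ I.head? = some 1 ∧ (I.sum : ℤ) ≤ (m : ℤ) - 2 ∧
      (J₂.sum : ℤ) ≤ (a : ℤ) - 1}

theorem finite_pairs (n : ℕ) : {p : List ℕ × List ℕ | IsComp (p.1 ++ p.2) n}.Finite := by
  refine (Set.finite_range (fun x : Composition n × Fin (n + 1) =>
    (x.1.blocks.take x.2, x.1.blocks.drop x.2))).subset ?_
  rintro ⟨I, J⟩ ⟨hpos, hsum⟩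
  let K : Composition n := ⟨I ++ J, fun {i} hi => hpos i hi, hsum⟩
  have hlen : (I ++ J).length ≤ n := K.length_le
  rw [List.length_append] at hlen
  exact ⟨(K, ⟨I.length, by omega⟩), by simp [K]⟩

theorem hatSet_finite (a m b : ℕ) : (hatSet a m b).Finite := by
  refine (finite_pairs (a + m + b)).subset ?_
  have key : ∀ I J₁ J₂ : List ℕ, IsComp (J₁ ++ I.reverse ++ J₂) (a + m + b) →
      IsComp (I ++ (J₁ ++ J₂)) (a + m + b) := by
    rintro I J₁ J₂ ⟨hpos, hsum⟩
    refine ⟨fun i hi => hpos i ?_, ?_⟩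
    · simp only [List.mem_append, List.mem_reverse] at hi ⊢
      tauto
    · simp only [List.sum_append, List.sum_reverse] at hsum ⊢
      omega
  rintro p ((⟨I, J, J₁, J₂, K, rfl, ⟨rfl, -⟩, rfl, h, -⟩ |
    ⟨I, J, J₁, J₂, K, rfl, ⟨rfl, -⟩, rfl, h, -⟩) | ⟨I, J, J₁, J₂, rfl, -, h, -⟩)
  · exact key I J₁ J₂ h
  · exact key I J₁ J₂ h
  · exact h

/-- `S_{a,m,b}` as a finite set. -/
noncomputable def hatPairs (a m b : ℕ) : Finset (List ℕ × List ℕ) := (hatSet_finite a m b).toFinset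

end ChromaticHat

open ChromaticHat

namespace ChromaticHat

/-! Put k = m - 1, and let P_n and C_n be the coloring sums of the path and the cycle. A proper
coloring of the hat is a word without equal neighbours whose letters at positions a and a + k
differ. Hence X is P_n minus the sum over words where these letters agree. Fixing the common letter
y splits such a word into a tail, a closed word from y to y, and another tail (`sum_hat_words`).
Moving vertices one by one from the closed word into a tail (`sum_tailSum_closedSum_tailSum`) gives
X = k P_n + ∑_{i<k} (k-1-i) P_{i+1} P_{n-1-i} - (k-1) ∑_{j<k} P_{b+1+j} P_{a+k-j} + ∑_{j<k}
P_{a+k-j} ∑_{i<j} P_{b+1+i} C_{j-i}. Newton's identities yield P_n = ∑ w_K e_K, and the recursion of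
the cycle yields C_n = ∑ (k₁-1) w_K e_K (`pathSum_eq_pathComp`, `cycleSum_eq_cycleComp`).

The rest is combinatorics of compositions, valid for an arbitrary sequence e (`sum_expansion`). By
telescoping, ∑ N_K w_K e_K = k P_n - ∑ P_{b+1+j} C_{a+k-j}. Therefore X is this sum, plus the sum of
(k-|I|) w_I w_J e_{IJ} over 1 ≤ |I| ≤ k, minus the sum of `cutN` times w_A w_B e_{AB} over cuts K =
AB with b+1 ≤ |A| ≤ b+k (`sum_cutN`). Cuts with `cutN` ≥ 0 cancel bijectively against the pairs (I,
J) outside S (`sum_cuts_complement`). Cuts with `cutN` < 0 correspond to the K with N_K < 0 and turn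
their coefficients into the positive ones with a denominator (`sum_neg_hatN`).

Power series in infinitely many variables are compared one coefficient at a time, where finitely
many variables suffice (`AgreeBelow`). -/

/-! ### Sums over proper words in a finite alphabet -/

section Words

variable {ι R : Type*} [Fintype ι] [CommRing R]

/-- `wordTransfer φ n y` is the sum of `∏ i : Fin _, φ i (u i)` over the words `u 0, …, u n` without equal
neighbours that end with the letter `y`. -/
def wordTransfer (φ : ℕ → ι → R) : ℕ → ι → R
  | 0 => φ 0
  | n + 1 => fun y => φ (n + 1) y * (∑ z, wordTransfer φ n z - wordTransfer φ n y)

/-- The test function ψ makes the induction close: removing the last letter replaces ψ by the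
function of the preceding letter that sums over all admissible last letters. -/
theorem sum_words_mul_last [DecidableEq ι] (φ : ℕ → ι → R) (n : ℕ) (ψ : ι → R) :
    ∑ u : Fin (n + 1) → ι, (if ∀ i : Fin n, u i.castSucc ≠ u i.succ then
        ∏ i : Fin _, φ i (u i) else 0) * ψ (u (Fin.last n)) =
      ∑ y, wordTransfer φ n y * ψ y := by
  induction n generalizing ψ with
  | zero =>
    rw [← (Equiv.funUnique (Fin 1) ι).symm.sum_comp]
    simp [wordTransfer]
  | succ n ih =>
    rw [← (Fin.snocEquiv (fun _ : Fin (n + 2) => ι)).sum_comp, Fintype.sum_prod_type,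
      Finset.sum_comm]
    have h : ∀ u : Fin (n + 1) → ι, ∀ y : ι,
        (if ∀ i : Fin (n + 1), (Fin.snocEquiv (fun _ : Fin (n + 2) => ι)) (y, u) i.castSucc ≠
            (Fin.snocEquiv (fun _ : Fin (n + 2) => ι)) (y, u) i.succ then
          ∏ i : Fin _, φ i ((Fin.snocEquiv (fun _ : Fin (n + 2) => ι)) (y, u) i) else 0) *
          ψ ((Fin.snocEquiv (fun _ : Fin (n + 2) => ι)) (y, u) (Fin.last (n + 1))) =
        (if ∀ i : Fin n, u i.castSucc ≠ u i.succ then ∏ i : Fin _, φ i (u i) else 0) *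
          (φ (n + 1) y * ψ y - if u (Fin.last n) = y then φ (n + 1) y * ψ y else 0) := by
      intro u y
      have hc : (∀ i : Fin (n + 1), (Fin.snocEquiv (fun _ : Fin (n + 2) => ι)) (y, u) i.castSucc ≠
            (Fin.snocEquiv (fun _ : Fin (n + 2) => ι)) (y, u) i.succ) ↔
          (∀ i : Fin n, u i.castSucc ≠ u i.succ) ∧ u (Fin.last n) ≠ y := by
        rw [Fin.forall_fin_succ']
        simp only [Fin.snocEquiv_apply, Fin.snoc_castSucc, ← Fin.castSucc_succ, Fin.succ_last,
          Fin.snoc_last]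
      simp only [hc, Fin.prod_univ_castSucc (n := n + 1)]
      simp only [Fin.snocEquiv_apply, Fin.snoc_castSucc, Fin.snoc_last, Fin.val_castSucc,
        Fin.val_last]
      by_cases h1 : ∀ i : Fin n, u i.castSucc ≠ u i.succ <;> by_cases h2 : u (Fin.last n) = y <;>
        simp [h1, h2, mul_assoc]
    simp only [h, ← Finset.mul_sum]
    rw [ih (fun z => ∑ y, (φ (n + 1) y * ψ y - if z = y then φ (n + 1) y * ψ y else 0))]
    simp only [wordTransfer, Finset.sum_sub_distrib, Finset.sum_ite_eq, Finset.mem_univ, if_true,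
      mul_sub, sub_mul, ← Finset.sum_mul]
    congr 1
    · simp only [mul_right_comm _ _ (ψ _)]
      rw [← Finset.sum_mul, mul_comm]
    · exact Finset.sum_congr rfl fun _ _ => by ring

theorem sum_words [DecidableEq ι] (φ : ℕ → ι → R) (n : ℕ) :
    ∑ u : Fin (n + 1) → ι, (if ∀ i : Fin n, u i.castSucc ≠ u i.succ then
        ∏ i : Fin _, φ i (u i) else 0) = ∑ y, wordTransfer φ n y := by
  simpa using sum_words_mul_last φ n (fun _ => 1)

variable (x : ι → R)

/-- The sum of `x z * φ z` over the letters `z ≠ y`. -/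
def extend (φ : ι → R) : ι → R := fun y => ∑ z, x z * φ z - x y * φ y

/-- `tailSum x n y` is the sum of the weights of the words `u` of length `n` such that `y u` has
no equal neighbours. -/
def tailSum (n : ℕ) : ι → R := (extend x)^[n] 1

/-- The sum of the weights of the words of length `n` without equal neighbours. -/
def pathSum : ℕ → R
  | 0 => 1
  | n + 1 => ∑ z, x z * tailSum x n z

/-- `closedSum x k y` is the sum of the weights of the words of length `k + 1` without equal
neighbours that begin and end with `y`. -/
def closedSum : ℕ → ι → R
  | 0 => x
  | k + 1 => fun y => x y * (x y * tailSum x k y - closedSum k y)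

@[simp] theorem tailSum_zero (y : ι) : tailSum x 0 y = 1 := rfl

/-- Inclusion–exclusion at the first edge: drop the condition that the word does not begin with y,
then subtract the words that do. All later relations between paths, cycles and spiders come from
this identity. -/
theorem tailSum_succ (n : ℕ) (y : ι) :
    tailSum x (n + 1) y = pathSum x (n + 1) - x y * tailSum x n y := by
  simp only [tailSum, Function.iterate_succ_apply']
  rfl

theorem wordTransfer_path (n : ℕ) (y : ι) :
    wordTransfer (fun _ => x) n y = x y * tailSum x n y := by
  induction n generalizing y with
  | zero => simp [wordTransfer]
  | succ n ih =>
    simp only [wordTransfer, ih]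
    rw [tailSum_succ]
    rfl

/-! ### Words with the same prescribed letter at two positions -/

/-- Words starting with a fixed letter `y₀`, whose weight is omitted. -/
def fromLetter [DecidableEq ι] (y₀ : ι) : ℕ → ι → R
  | 0 => fun y => if y = y₀ then 1 else 0
  | n + 1 => fun y => x y * (∑ z, fromLetter y₀ n z - fromLetter y₀ n y)

variable [DecidableEq ι]

/-- One step of `fromLetter` is the transpose of `extend`, so the recursion may be run from either
end of the word. -/
theorem sum_fromLetter_mul (y₀ : ι) (n : ℕ) (φ : ι → R) :
    ∑ y, fromLetter x y₀ n y * φ y = (extend x)^[n] φ y₀ := by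
  induction n generalizing φ with
  | zero => simp [fromLetter]
  | succ n ih =>
    rw [Function.iterate_succ_apply, ← ih]
    simp only [fromLetter, extend, mul_sub, sub_mul, Finset.sum_sub_distrib, ← Finset.sum_mul]
    congr 1
    · simp only [mul_right_comm (x _)]
      rw [← Finset.sum_mul, mul_comm]
    · exact Finset.sum_congr rfl fun _ _ => by ring

theorem sum_fromLetter (y₀ : ι) (n : ℕ) : ∑ y, fromLetter x y₀ n y = tailSum x n y₀ := by
  simpa [tailSum] using sum_fromLetter_mul x y₀ n 1

theorem mul_fromLetter_self (y₀ : ι) (n : ℕ) :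
    x y₀ * fromLetter x y₀ n y₀ = closedSum x n y₀ := by
  induction n with
  | zero => simp [fromLetter, closedSum]
  | succ n ih =>
    simp only [fromLetter, closedSum, sum_fromLetter]
    rw [← ih]; ring

/-- The vertex weights that force the letter `y₀` at the positions `a` and `a + k`. -/
def pinned (a k : ℕ) (y₀ : ι) (i : ℕ) (y : ι) : R :=
  if i = a ∨ i = a + k then (if y = y₀ then x y else 0) else x y

theorem wordTransfer_pinned_left (a k : ℕ) (y₀ y : ι) (i : ℕ) (hi : i < a) :
    wordTransfer (pinned x a k y₀) i y = x y * tailSum x i y := by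
  induction i generalizing y with
  | zero =>
    simp [wordTransfer, pinned, hi.ne]
    omega
  | succ i ih =>
    have h1 : ¬ (i + 1 = a ∨ i + 1 = a + k) := by omega
    simp only [wordTransfer, pinned, h1, if_false, ih _ (by omega : i < a)]
    rw [tailSum_succ]
    rfl

/-- At a pinned position the past enters only through a scalar, and the transfer restarts from the
single letter y₀. -/
theorem wordTransfer_pinned_start (a k : ℕ) (y₀ y : ι) :
    wordTransfer (pinned x a k y₀) a y = x y₀ * tailSum x a y₀ * fromLetter x y₀ 0 y := by
  cases a with
  | zero =>
    simp only [wordTransfer, pinned, true_or, if_true, fromLetter]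
    split_ifs with h <;> simp [h]
  | succ a =>
    simp only [wordTransfer, pinned, true_or, if_true, fromLetter,
      wordTransfer_pinned_left x (a + 1) k y₀ _ a (Nat.lt_succ_self a)]
    split_ifs with h
    · subst h
      rw [tailSum_succ, mul_one]
      rfl
    · simp

theorem wordTransfer_pinned_middle (a k : ℕ) (y₀ y : ι) (j : ℕ) (hj : j < k) :
    wordTransfer (pinned x a k y₀) (a + j) y =
      x y₀ * tailSum x a y₀ * fromLetter x y₀ j y := by
  induction j generalizing y with
  | zero => exact wordTransfer_pinned_start x a k y₀ y
  | succ j ih =>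
    have h1 : ¬ (a + j + 1 = a ∨ a + j + 1 = a + k) := by omega
    rw [← add_assoc, wordTransfer]
    simp only [pinned, h1, if_false, ih _ (by omega : j < k), fromLetter, ← Finset.mul_sum]
    ring

theorem wordTransfer_pinned_right (a k : ℕ) (hk : 0 < k) (y₀ y : ι) (j : ℕ) :
    wordTransfer (pinned x a k y₀) (a + k + j) y =
      tailSum x a y₀ * closedSum x k y₀ * fromLetter x y₀ j y := by
  induction j generalizing y with
  | zero =>
    obtain ⟨k, rfl⟩ : ∃ l, k = l + 1 := ⟨k - 1, by omega⟩
    have h1 : (a + k + 1 = a ∨ a + k + 1 = a + (k + 1)) := by omega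
    rw [add_zero, ← add_assoc, ← mul_fromLetter_self]
    simp only [wordTransfer, pinned, h1, if_true,
      wordTransfer_pinned_middle x a (k + 1) y₀ _ k (Nat.lt_succ_self k), fromLetter]
    rw [← Finset.mul_sum]
    split_ifs with h
    · subst h; ring
    · simp
  | succ j ih =>
    have h1 : ¬ (a + k + j + 1 = a ∨ a + k + j + 1 = a + k) := by omega
    rw [← add_assoc, wordTransfer]
    simp only [pinned, h1, if_false, ih, fromLetter, ← Finset.mul_sum]
    ring

/-- The sum of the weights of the words of length `a + k + 1 + b` without equal neighbours whose
letters at the positions `a` and `a + k` differ. -/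
theorem sum_hat_words (a k b : ℕ) (hk : 0 < k) :
    ∑ u : Fin (a + k + b + 1) → ι,
        (if (∀ i : Fin (a + k + b), u i.castSucc ≠ u i.succ) ∧
          u ⟨a, by omega⟩ ≠ u ⟨a + k, by omega⟩ then ∏ i, x (u i) else 0) =
      pathSum x (a + k + b + 1) - ∑ y, tailSum x a y * closedSum x k y * tailSum x b y := by
  have h1 := sum_words (fun _ => x) (a + k + b)
  simp only [wordTransfer_path] at h1
  have h2 : ∀ y, ∑ u : Fin (a + k + b + 1) → ι,
      (if ∀ i : Fin (a + k + b), u i.castSucc ≠ u i.succ then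
        ∏ i : Fin _, pinned x a k y i (u i) else 0) =
      tailSum x a y * closedSum x k y * tailSum x b y := by
    intro y
    rw [sum_words]
    simp only [wordTransfer_pinned_right x a k hk, ← Finset.mul_sum, sum_fromLetter]
  rw [show pathSum x (a + k + b + 1) = _ from h1.symm]
  simp only [← h2]
  rw [Finset.sum_comm, ← Finset.sum_sub_distrib]
  refine Finset.sum_congr rfl fun u _ => ?_
  by_cases hu : ∀ i : Fin (a + k + b), u i.castSucc ≠ u i.succ
  -- Summed over y, the pinned products give the weight of u exactly when its letters at a and a + k
  -- agree.
  · have h3 : ∀ y, ∏ i : Fin _, pinned x a k y i (u i) =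
        if u ⟨a, by omega⟩ = y then
          (if u ⟨a + k, by omega⟩ = y then ∏ i, x (u i) else 0) else 0 := by
      intro y
      split_ifs with h4 h5
      · refine Finset.prod_congr rfl fun i _ => ?_
        simp only [pinned]
        split_ifs with h6 h7
        · rfl
        · exfalso
          rcases h6 with h6 | h6
          · exact h7 (by rw [← h4]; congr 1; exact Fin.ext h6)
          · exact h7 (by rw [← h5]; congr 1; exact Fin.ext h6)
        · rfl
      · exact Finset.prod_eq_zero (Finset.mem_univ ⟨a + k, by omega⟩) (by simp [pinned, h5])
      · exact Finset.prod_eq_zero (Finset.mem_univ ⟨a, by omega⟩) (by simp [pinned, h4])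
    simp only [h3]
    by_cases h : u ⟨a, by omega⟩ = u ⟨a + k, by omega⟩
    · simp [h]
    · simp [h, Ne.symm h]
  · simp [hu]

end Words

/-! ### Hats in terms of paths and cycles -/

section HatPath

variable {ι R : Type*} [Fintype ι] [CommRing R] (x : ι → R)

theorem sum_mul_tailSum (b : ℕ) : ∑ y, x y * tailSum x b y = pathSum x (b + 1) := rfl

/-- Two tails glued at y form a path. Shifting the glued vertex by one creates two correction terms,
which cancel after summation over y. -/
theorem sum_mul_tailSum_mul_tailSum (a b : ℕ) :
    ∑ y, x y * tailSum x a y * tailSum x b y = pathSum x (a + b + 1) := by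
  induction b generalizing a with
  | zero => simp [sum_mul_tailSum]
  | succ b ih =>
    have h : ∀ y, x y * tailSum x a y * tailSum x (b + 1) y =
        x y * tailSum x (a + 1) y * tailSum x b y +
          (pathSum x (b + 1) * (x y * tailSum x a y) -
            pathSum x (a + 1) * (x y * tailSum x b y)) := by
      intro y
      rw [tailSum_succ, tailSum_succ]; ring
    simp only [h, Finset.sum_add_distrib, Finset.sum_sub_distrib, ← Finset.mul_sum, ih,
      sum_mul_tailSum]
    rw [show a + 1 + b + 1 = a + (b + 1) + 1 by ring]
    ring

/-- The spider with three legs of lengths `a`, `b`, `c`. -/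
theorem sum_spider (a b c : ℕ) :
    ∑ y, x y * tailSum x a y * tailSum x b y * tailSum x c y =
      pathSum x (a + b + c + 1) + ∑ j ∈ Finset.range c,
        pathSum x (j + 1) * pathSum x (a + b + c - j) -
        ∑ j ∈ Finset.range c, pathSum x (b + 1 + j) * pathSum x (a + c - j) := by
  induction c generalizing b with
  | zero => simp [sum_mul_tailSum_mul_tailSum]
  | succ c ih =>
    -- A vertex moves from the third leg to the second. By `tailSum_succ` on both legs, the
    -- corrections are products in which one leg is split off as a path.
    have h : ∀ y, x y * tailSum x a y * tailSum x b y * tailSum x (c + 1) y =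
        x y * tailSum x a y * tailSum x (b + 1) y * tailSum x c y +
          (pathSum x (c + 1) * (x y * tailSum x a y * tailSum x b y) -
            pathSum x (b + 1) * (x y * tailSum x a y * tailSum x c y)) := by
      intro y
      rw [tailSum_succ x c, tailSum_succ x b]; ring
    simp only [h, Finset.sum_add_distrib, Finset.sum_sub_distrib, ← Finset.mul_sum, ih,
      sum_mul_tailSum_mul_tailSum]
    rw [Finset.sum_range_succ, Finset.sum_range_succ']
    rw [show a + (b + 1) + c = a + b + (c + 1) by ring,
      show a + b + (c + 1) - c = a + b + 1 by omega]
    have h2 : ∀ j ∈ Finset.range c, pathSum x (b + 1 + (j + 1)) * pathSum x (a + (c + 1) - (j + 1))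
        = pathSum x (b + 1 + 1 + j) * pathSum x (a + c - j) := by
      intro j _
      congr 2
      · ring
      · omega
    rw [Finset.sum_congr rfl h2]
    simp only [add_zero, Nat.sub_zero, add_assoc]
    ring

/-- The sum of the weights of the proper colorings of the cycle of length `k`. -/
def cycleSum : ℕ → R
  | 0 => 0
  | k + 1 => pathSum x (k + 1) - ∑ y, closedSum x k y

/-- The sum of the products of a path and a cycle of sizes `b + 1, …, b + k` and
`k, …, 1` respectively. -/
def pathCycleSum (b k : ℕ) : R :=
  ∑ j ∈ Finset.range k, pathSum x (b + 1 + j) * cycleSum x (k - j)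

/-- Opening the closed word at its last edge moves one vertex to the tail. The corrections combine
into P_{b+1} C_{k+1} and one full path. -/
theorem sum_tadpole (k b : ℕ) :
    ∑ y, closedSum x k y * tailSum x b y =
      pathCycleSum x b k - ((k : R) - 1) * pathSum x (b + k + 1) := by
  induction k generalizing b with
  | zero => simp [closedSum, pathCycleSum, sum_mul_tailSum]
  | succ k ih =>
    have h : ∀ y, closedSum x (k + 1) y * tailSum x b y =
        closedSum x k y * tailSum x (b + 1) y +
        (pathSum x (b + 1) * (x y * tailSum x k y) - pathSum x (b + 1) * closedSum x k y -
          x y * tailSum x (b + 1) y * tailSum x k y) := by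
      intro y
      rw [closedSum, tailSum_succ]; ring
    simp only [h, Finset.sum_add_distrib, Finset.sum_sub_distrib, ← Finset.mul_sum, ih,
      sum_mul_tailSum_mul_tailSum, sum_mul_tailSum]
    have h2 : pathCycleSum x b (k + 1) = pathCycleSum x (b + 1) k +
        pathSum x (b + 1) * cycleSum x (k + 1) := by
      simp only [pathCycleSum]
      rw [Finset.sum_range_succ']
      congr 1
      refine Finset.sum_congr rfl fun j _ => ?_
      congr 2
      · ring
      · omega
    rw [h2, cycleSum, show b + 1 + k = b + (k + 1) by ring]
    push_cast
    ring

/-- The case of an empty tail in `sum_tadpole`; it determines the cycles recursively from the paths.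
-/
theorem cycleSum_eq (k : ℕ) (hk : 0 < k) :
    cycleSum x k = ((k : R) - 1) * pathSum x k -
      ∑ j ∈ Finset.range (k - 1), pathSum x (1 + j) * cycleSum x (k - 1 - j) := by
  obtain ⟨k, rfl⟩ : ∃ l, k = l + 1 := ⟨k - 1, by omega⟩
  have h := sum_tadpole x k 0
  simp only [tailSum_zero, mul_one, zero_add, pathCycleSum] at h
  rw [cycleSum, h, Nat.add_sub_cancel]
  push_cast
  ring

/-- The same unwinding with two tails, moving vertices to the tail of length a. Each step leaves a
path times a path, a path times a tadpole, and a spider with legs a + 1, b, k, all known already. -/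
theorem sum_tailSum_closedSum_tailSum (a k b : ℕ) :
    ∑ y, tailSum x a y * closedSum x k y * tailSum x b y =
      - (((k : R) - 1) * pathSum x (a + k + b + 1))
      - ∑ i ∈ Finset.range k, ((k : R) - 1 - i) * (pathSum x (i + 1) * pathSum x (a + k + b - i))
      + ((k : R) - 1) * ∑ j ∈ Finset.range k, pathSum x (b + 1 + j) * pathSum x (a + k - j)
      - ∑ j ∈ Finset.range k, pathSum x (a + k - j) * pathCycleSum x b j := by
  induction k generalizing a with
  | zero =>
    have h := sum_mul_tailSum_mul_tailSum x a b
    simp only [mul_comm (x _)] at h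
    simp [closedSum, h]
  | succ k ih =>
    have h : ∀ y, tailSum x a y * closedSum x (k + 1) y * tailSum x b y =
        tailSum x (a + 1) y * closedSum x k y * tailSum x b y +
        (pathSum x (a + 1) * (x y * tailSum x b y * tailSum x k y) -
          pathSum x (a + 1) * (closedSum x k y * tailSum x b y) -
          x y * tailSum x (a + 1) y * tailSum x b y * tailSum x k y) := by
      intro y
      rw [closedSum, tailSum_succ]; ring
    simp only [h, Finset.sum_add_distrib, Finset.sum_sub_distrib, ← Finset.mul_sum, ih,
      sum_mul_tailSum_mul_tailSum, sum_spider, sum_tadpole]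
    simp only [Finset.sum_range_succ _ k]
    rw [show a + 1 + k = a + (k + 1) by ring, show a + 1 + b + k = a + (k + 1) + b by ring,
      show a + (k + 1) - k = a + 1 by omega]
    -- Each coefficient k - 1 - i grows by one with k; the increment is the first sum contributed by
    -- the spider.
    have h2 : ∑ i ∈ Finset.range k, (((k + 1 : ℕ) : R) - 1 - i) *
          (pathSum x (i + 1) * pathSum x (a + (k + 1) + b - i)) =
        ∑ i ∈ Finset.range k, ((k : R) - 1 - i) *
          (pathSum x (i + 1) * pathSum x (a + (k + 1) + b - i)) +
        ∑ i ∈ Finset.range k, pathSum x (i + 1) * pathSum x (a + (k + 1) + b - i) := by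
      rw [← Finset.sum_add_distrib]
      refine Finset.sum_congr rfl fun i _ => ?_
      push_cast
      ring
    rw [h2, show b + 1 + k = b + k + 1 by ring]
    push_cast
    ring

end HatPath

/-! ### The recursion for paths in terms of elementary symmetric functions -/

section Newton

variable {ι R : Type*} [Fintype ι] [CommRing R] (x : ι → R)

/-- The elementary symmetric function of the finite family `x`. -/
def finElem (k : ℕ) : R := ∑ s ∈ Finset.powersetCard k Finset.univ, ∏ i ∈ s, x i

@[simp] theorem finElem_zero : finElem x 0 = 1 := by simp [finElem]

theorem aeval_esymm_eq_finElem (k : ℕ) :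
    MvPolynomial.aeval x (MvPolynomial.esymm ι ℤ k) = finElem x k := by
  simp [MvPolynomial.esymm, finElem]

/-- Newton's identities on the full antidiagonal. Setting the power sum of degree 0 to 0 makes the
right side a coefficient of a product of power series. -/
theorem mul_finElem (k : ℕ) :
    (k : R) * finElem x k = ∑ a ∈ Finset.HasAntidiagonal.antidiagonal k,
      finElem x a.1 * (if a.2 = 0 then 0 else (-1) ^ (a.2 + 1) * ∑ y, x y ^ a.2) := by
  classical
  have h := congrArg (MvPolynomial.aeval x) (MvPolynomial.mul_esymm_eq_sum ι ℤ k)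
  simp only [map_mul, map_natCast, aeval_esymm_eq_finElem, map_pow, map_neg, map_one, map_sum,
    MvPolynomial.psum, MvPolynomial.aeval_X] at h
  rw [h, Finset.mul_sum, Finset.sum_filter]
  refine Finset.sum_congr rfl fun a ha => ?_
  rw [Finset.HasAntidiagonal.mem_antidiagonal] at ha
  by_cases h0 : a.2 = 0
  · simp [h0, show ¬ a.1 < k by omega]
  · rw [if_pos (by omega), if_neg h0, ← ha]
    have h1 : ((-1 : R)) ^ (a.1 + a.2 + 1) * (-1) ^ a.1 = (-1) ^ (a.2 + 1) := by
      rw [← pow_add, show a.1 + a.2 + 1 + a.1 = 2 * a.1 + (a.2 + 1) by ring, pow_add, pow_mul]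
      simp
    rw [← h1]
    ring

theorem tailSum_eq (n : ℕ) (y : ι) :
    tailSum x n y = ∑ a ∈ Finset.HasAntidiagonal.antidiagonal n, (-x y) ^ a.1 * pathSum x a.2 := by
  induction n with
  | zero => simp [pathSum]
  | succ n ih =>
    rw [tailSum_succ, ih, Finset.Nat.antidiagonal_succ, Finset.sum_cons, Finset.sum_map,
      Finset.mul_sum, sub_eq_add_neg, ← Finset.sum_neg_distrib]
    simp only [pow_zero, one_mul, Function.Embedding.prodMap, Function.Embedding.coeFn_mk,
      Prod.map, Function.Embedding.refl_apply, pow_succ]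
    congr 1
    exact Finset.sum_congr rfl fun a _ => by ring

/-- With S the series of signed power sums, this is P = 1 + S P; it comes from unwinding
`tailSum_succ` completely. -/
theorem pathSum_succ_eq (n : ℕ) :
    pathSum x (n + 1) = ∑ a ∈ Finset.HasAntidiagonal.antidiagonal (n + 1),
      (if a.1 = 0 then 0 else (-1) ^ (a.1 + 1) * ∑ y, x y ^ a.1) * pathSum x a.2 := by
  rw [Finset.Nat.antidiagonal_succ, Finset.sum_cons, Finset.sum_map]
  simp only [if_true, zero_mul, zero_add, Function.Embedding.prodMap, Function.Embedding.coeFn_mk,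
      Prod.map, Function.Embedding.refl_apply, Nat.succ_ne_zero, if_false]
  rw [pathSum]
  simp only [tailSum_eq, Finset.mul_sum]
  rw [Finset.sum_comm]
  refine Finset.sum_congr rfl fun a _ => ?_
  rw [Finset.sum_mul]
  refine Finset.sum_congr rfl fun y _ => ?_
  rw [neg_pow]
  simp only [Nat.succ_eq_add_one]
  ring

/-- Eliminating S between D = E S (Newton) and P = 1 + S P gives (E - D) P = E, a recursion for
paths free of power sums. -/
theorem sum_finElem_mul_pathSum (n : ℕ) :
    ∑ a ∈ Finset.HasAntidiagonal.antidiagonal n, (finElem x a.1 - a.1 * finElem x a.1) * pathSum x a.2 =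
      finElem x n := by
  set P : PowerSeries R := PowerSeries.mk (pathSum x)
  set E : PowerSeries R := PowerSeries.mk (finElem x)
  set D : PowerSeries R := PowerSeries.mk fun k => (k : R) * finElem x k
  set S : PowerSeries R := PowerSeries.mk fun k =>
    if k = 0 then 0 else (-1) ^ (k + 1) * ∑ y, x y ^ k
  have h1 : D = E * S := by
    ext k
    simp only [D, E, S, PowerSeries.coeff_mul, PowerSeries.coeff_mk]
    exact mul_finElem x k
  have h2 : P = 1 + S * P := by
    ext k
    cases k with
    | zero => simp [P, S, pathSum]
    | succ k =>
      simp only [P, S, map_add, PowerSeries.coeff_mul, PowerSeries.coeff_mk, PowerSeries.coeff_one,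
        Nat.succ_ne_zero, if_false, zero_add]
      exact pathSum_succ_eq x k
  have h3 : (E - D) * P = E := by
    calc (E - D) * P = E * P - E * (S * P) := by rw [h1]; ring
      _ = E * (1 + S * P) - E * (S * P) := by rw [← h2]
      _ = E := by ring
  have h4 := congrArg (PowerSeries.coeff n) h3
  simpa only [P, E, D, PowerSeries.coeff_mul, PowerSeries.coeff_mk, map_sub] using h4

theorem pathSum_eq (n : ℕ) (hn : 0 < n) :
    pathSum x n = finElem x n +
      ∑ k ∈ Finset.range n, (k : R) * (finElem x (k + 1) * pathSum x (n - 1 - k)) := by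
  obtain ⟨n, rfl⟩ : ∃ l, n = l + 1 := ⟨n - 1, by omega⟩
  rw [← sum_finElem_mul_pathSum x (n + 1), Finset.Nat.antidiagonal_succ, Finset.sum_cons,
    Finset.sum_map, Finset.Nat.sum_antidiagonal_eq_sum_range_succ_mk, add_assoc,
    ← Finset.sum_add_distrib]
  rw [Finset.sum_eq_zero]
  · simp
  · intro k _
    simp
    ring

end Newton

/-! ### Partial sums of compositions -/

/-- View a composition as a row of cells 1, …, |L| cut into blocks. Locating the block of cell c
puts L in the form in which σ⁺ and σ⁻ can be read off. -/
theorem exists_block (L : List ℕ) (c : ℕ) (h1 : 0 < c) (h2 : c ≤ L.sum) :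
    ∃ X i Y, L = X ++ i :: Y ∧ X.sum < c ∧ c ≤ X.sum + i := by
  induction L generalizing c with
  | nil => simp at h2; omega
  | cons j L ih =>
    by_cases h : c ≤ j
    · exact ⟨[], j, L, rfl, by simpa using h1, by simpa using h⟩
    · rw [List.sum_cons] at h2
      obtain ⟨X, i, Y, rfl, h3, h4⟩ := ih (c - j) (by omega) (by omega)
      exact ⟨j :: X, i, Y, rfl, by simp; omega, by simp; omega⟩

theorem sum_take_mono (L : List ℕ) {k l : ℕ} (h : k ≤ l) : (L.take k).sum ≤ (L.take l).sum := by
  obtain ⟨d, rfl⟩ := Nat.exists_eq_add_of_le h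
  rw [List.take_add, List.sum_append]
  exact Nat.le_add_right _ _

theorem sum_take_dichotomy (X Y : List ℕ) (i k : ℕ) :
    ((X ++ i :: Y).take k).sum ≤ X.sum ∨ X.sum + i ≤ ((X ++ i :: Y).take k).sum := by
  rcases Nat.lt_or_ge X.length k with h | h
  · right
    have := sum_take_mono (X ++ i :: Y) h
    refine le_trans (le_of_eq ?_) this
    rw [List.take_append]
    simp [List.take_of_length_le]
  · left
    have := sum_take_mono (X ++ i :: Y) h
    simpa using this

theorem sigmaPlus_append_cons {X Y : List ℕ} {i c : ℕ} (h1 : X.sum < c) (h2 : c ≤ X.sum + i) :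
    sigmaPlus (X ++ i :: Y) c = X.sum + i := by
  refine IsLeast.csInf_eq ⟨⟨X.length + 1, by simp, ?_, h2⟩, ?_⟩
  · rw [List.take_append]
    simp [List.take_of_length_le]
  · rintro s ⟨k, -, rfl, hs⟩
    rcases sum_take_dichotomy X Y i k with h | h
    · omega
    · exact h

theorem sigmaPlus_append {A B : List ℕ} {c : ℕ} (h1 : 0 < c) (h2 : c ≤ A.sum) :
    sigmaPlus (A ++ B) c = sigmaPlus A c := by
  obtain ⟨X, i, Y, rfl, h3, h4⟩ := exists_block A c h1 h2
  rw [List.append_assoc, List.cons_append, sigmaPlus_append_cons h3 h4,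
    sigmaPlus_append_cons h3 h4]

theorem le_sigmaPlus {A : List ℕ} {c : ℕ} (h1 : 0 < c) (h2 : c ≤ A.sum) : c ≤ sigmaPlus A c := by
  obtain ⟨X, i, Y, rfl, h3, h4⟩ := exists_block A c h1 h2
  rwa [sigmaPlus_append_cons h3 h4]

theorem sigmaPlus_sum {A : List ℕ} (h : 0 < A.sum) : sigmaPlus A A.sum = A.sum := by
  obtain ⟨X, i, Y, hA, h3, h4⟩ := exists_block A A.sum h le_rfl
  have h5 : A.sum = X.sum + (i + Y.sum) := by rw [hA]; simp
  have h6 := sigmaPlus_append_cons (Y := Y) h3 h4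
  rw [← hA] at h6
  omega

theorem bddAbove_sigmaMinus (L : List ℕ) (c : ℕ) :
    BddAbove {s | ∃ k ≤ L.length, s = (L.take k).sum ∧ s ≤ c} :=
  ⟨c, by rintro s ⟨k, -, -, hs⟩; exact hs⟩

theorem sigmaMinus_append_cons {X Y : List ℕ} {i c : ℕ} (h1 : X.sum ≤ c) (h2 : c < X.sum + i) :
    sigmaMinus (X ++ i :: Y) c = X.sum := by
  refine IsGreatest.csSup_eq ⟨⟨X.length, by simp, by simp, h1⟩, ?_⟩
  rintro s ⟨k, -, rfl, hs⟩
  rcases sum_take_dichotomy X Y i k with h | h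
  · exact h
  · omega

/-- No bound relates c to X. Applied to the reversal of K, this decodes the condition on σ⁻ in the
first part of S. -/
theorem lt_sigmaMinus_append_cons {X Y : List ℕ} {i c : ℕ} (hi : 0 < i) :
    X.sum < sigmaMinus (X ++ i :: Y) c ↔ X.sum + i ≤ c := by
  constructor
  · intro h
    by_contra! h2
    rcases le_or_gt X.sum c with h3 | h3
    · rw [sigmaMinus_append_cons h3 h2] at h
      exact lt_irrefl _ h
    · have h4 : sigmaMinus (X ++ i :: Y) c ≤ c :=
        csSup_le ⟨0, 0, by simp, by simp, by simp⟩ (by rintro s ⟨k, -, -, hs⟩; exact hs)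
      omega
  · intro h
    have h2 : X.sum + i ≤ sigmaMinus (X ++ i :: Y) c := by
      refine le_csSup (bddAbove_sigmaMinus _ _) ⟨X.length + 1, by simp, ?_, h⟩
      rw [List.take_append]
      simp [List.take_of_length_le]
    omega

/-- Positive parts make the partial sums strictly increasing, so a cut is determined by the size of
its left piece. -/
theorem append_inj_of_sum_eq {A B A' B' : List ℕ} (h : A ++ B = A' ++ B')
    (hpos : ∀ i ∈ A ++ B, 0 < i) (hs : A.sum = A'.sum) : A = A' ∧ B = B' := by
  have nil_of : ∀ C : List ℕ, (∀ i ∈ C, 0 < i) → C.sum = 0 → C = [] := by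
    intro C hC h0
    cases C with
    | nil => rfl
    | cons c C =>
      have := hC c (by simp)
      simp at h0
      omega
  rcases List.append_eq_append_iff.mp h with ⟨C, rfl, rfl⟩ | ⟨C, rfl, rfl⟩
  · have : C = [] := nil_of C (fun i hi => hpos i (by simp [hi])) (by simpa using hs)
    simp [this]
  · have : C = [] := nil_of C (fun i hi => hpos i (by simp [hi])) (by simpa using hs)
    simp [this]

/-- The bisection of `L` after the block that contains the cell `c`. -/
def bisect : ℕ → List ℕ → List ℕ × List ℕ
  | _, [] => ([], [])
  | c, i :: L => if c ≤ i then ([i], L) else (i :: (bisect (c - i) L).1, (bisect (c - i) L).2)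

theorem bisect_append_cons {X Y : List ℕ} {i c : ℕ} (h1 : X.sum < c) (h2 : c ≤ X.sum + i) :
    bisect c (X ++ i :: Y) = (X ++ [i], Y) := by
  induction X generalizing c with
  | nil =>
    simp only [List.sum_nil, zero_add] at h2
    simp [bisect, h2]
  | cons j X ih =>
    rw [List.sum_cons] at h1 h2
    simp [bisect, show ¬ c ≤ j by omega, ih (c := c - j) (by omega) (by omega)]

/-! ### Weights -/

/-- The product of `i - 1` over the parts `i`. -/
def redWeight (I : List ℕ) : ℚ := (I.map fun j : ℕ => (j : ℚ) - 1).prod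

theorem weight_cons (i : ℕ) (I : List ℕ) : weight (i :: I) = i * redWeight I := by
  -- In the body of `weight` the list is coerced to a list of rationals, which unfolds to a
  -- `flatMap`.
  have h : ∀ L : List ℕ, L.flatMap (fun a : ℕ => [(a : ℚ)]) = L.map fun a : ℕ => (a : ℚ) := by
    intro L
    induction L <;> simp_all
  simp [weight, redWeight, h, Function.comp_def]

theorem redWeight_cons (i : ℕ) (I : List ℕ) : redWeight (i :: I) = ((i : ℚ) - 1) * redWeight I := by
  simp [redWeight]

theorem redWeight_append (A B : List ℕ) : redWeight (A ++ B) = redWeight A * redWeight B := by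
  simp [redWeight]

theorem redWeight_reverse (A : List ℕ) : redWeight A.reverse = redWeight A := by
  simp [redWeight, List.prod_reverse]

theorem weight_append {A : List ℕ} (B : List ℕ) (hA : A ≠ []) :
    weight (A ++ B) = weight A * redWeight B := by
  obtain ⟨i, A, rfl⟩ := List.exists_cons_of_ne_nil hA
  rw [List.cons_append, weight_cons, weight_cons, redWeight_append, mul_assoc]

theorem redWeight_nonneg {I : List ℕ} (h : ∀ i ∈ I, 0 < i) : 0 ≤ redWeight I := by
  refine List.prod_nonneg ?_
  simp only [List.mem_map]
  rintro _ ⟨j, hj, rfl⟩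
  have : (1 : ℚ) ≤ j := by exact_mod_cast h j hj
  linarith

theorem weight_nonneg {I : List ℕ} (h : ∀ i ∈ I, 0 < i) : 0 ≤ weight I := by
  cases I with
  | nil => simp [weight]
  | cons i I =>
    rw [weight_cons]
    exact mul_nonneg (Nat.cast_nonneg i) (redWeight_nonneg fun j hj => h j (by simp [hj]))

/-! ### Finite sets of compositions -/

theorem isComp_append {A B : List ℕ} {k l : ℕ} (hA : IsComp A k) (hB : IsComp B l) :
    IsComp (A ++ B) (k + l) := by
  refine ⟨fun i hi => ?_, by rw [List.sum_append, hA.2, hB.2]⟩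
  rcases List.mem_append.mp hi with h | h
  · exact hA.1 i h
  · exact hB.1 i h

theorem IsComp.left {A B : List ℕ} {n : ℕ} (h : IsComp (A ++ B) n) : IsComp A A.sum :=
  ⟨fun i hi => h.1 i (by simp [hi]), rfl⟩

theorem IsComp.right {A B : List ℕ} {n : ℕ} (h : IsComp (A ++ B) n) : IsComp B (n - A.sum) :=
  ⟨fun i hi => h.1 i (by simp [hi]), by have := h.2; rw [List.sum_append] at this; omega⟩

/-- The compositions of `n` as lists. -/
def comps (n : ℕ) : Finset (List ℕ) := Finset.univ.image (Composition.blocks (n := n))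

theorem mem_comps {n : ℕ} {K : List ℕ} : K ∈ comps n ↔ IsComp K n := by
  simp only [comps, Finset.mem_image, Finset.mem_univ, true_and]
  constructor
  · rintro ⟨c, rfl⟩
    exact ⟨fun i hi => c.blocks_pos hi, c.blocks_sum⟩
  · rintro ⟨h1, h2⟩
    exact ⟨⟨K, fun {i} hi => h1 i hi, h2⟩, rfl⟩

theorem sum_composition {M : Type*} [AddCommMonoid M] (n : ℕ) (F : List ℕ → M) :
    ∑ K : Composition n, F K.blocks = ∑ K ∈ comps n, F K := by
  rw [comps, Finset.sum_image]
  intro c _ c' _ h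
  exact Composition.ext h

theorem comps_zero : comps 0 = {[]} := by
  ext K
  rw [mem_comps, Finset.mem_singleton]
  constructor
  · rintro ⟨h1, h2⟩
    exact (append_inj_of_sum_eq (A := K) (B := []) (A' := []) (B' := K) (by simp)
      (by simpa using h1) (by simpa using h2)).1
  · rintro rfl
    exact ⟨by simp, rfl⟩

theorem IsComp.ne_nil {K : List ℕ} {n : ℕ} (h : IsComp K n) (hn : 0 < n) : K ≠ [] := by
  rintro rfl
  have := h.2
  simp at this
  omega

/-- Pairs of compositions with total size `n`. -/
noncomputable def compPairs (n : ℕ) : Finset (List ℕ × List ℕ) := (finite_pairs n).toFinset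

theorem mem_compPairs {n : ℕ} {p : List ℕ × List ℕ} :
    p ∈ compPairs n ↔ IsComp (p.1 ++ p.2) n := by
  simp [compPairs]

/-- Grading pairs by |A| turns sums over cuts into sums of products of path and cycle expansions.
The bound on l + j prevents truncation in n - (l + i). -/
theorem sum_compPairs_filter {M : Type*} [AddCommMonoid M] (n l j : ℕ) (h : l + j ≤ n + 1)
    (g : List ℕ × List ℕ → M) :
    ∑ p ∈ compPairs n with l ≤ p.1.sum ∧ p.1.sum < l + j, g p =
      ∑ i ∈ Finset.range j, ∑ A ∈ comps (l + i), ∑ B ∈ comps (n - (l + i)), g (A, B) := by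
  simp only [← Finset.sum_product']
  rw [Finset.sum_sigma']
  symm
  refine Finset.sum_bij' (fun q _ => q.2) (fun p _ => ⟨p.1.sum - l, p⟩) ?_ ?_ ?_ ?_ ?_
  · rintro ⟨i, A, B⟩ hq
    simp only [Finset.mem_sigma, Finset.mem_range, Finset.mem_product, mem_comps] at hq
    simp only [Finset.mem_filter, mem_compPairs]
    obtain ⟨h1, h2, h3⟩ := hq
    have := isComp_append h2 h3
    rw [show l + i + (n - (l + i)) = n by omega] at this
    exact ⟨this, by rw [h2.2]; omega, by rw [h2.2]; omega⟩
  · rintro ⟨A, B⟩ hp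
    simp only [Finset.mem_filter, mem_compPairs] at hp
    simp only [Finset.mem_sigma, Finset.mem_range, Finset.mem_product, mem_comps]
    obtain ⟨h1, h2, h3⟩ := hp
    rw [show l + (A.sum - l) = A.sum by omega]
    exact ⟨by omega, h1.left, h1.right⟩
  · rintro ⟨i, A, B⟩ hq
    simp only [Finset.mem_sigma, Finset.mem_range, Finset.mem_product, mem_comps] at hq
    obtain ⟨h1, h2, h3⟩ := hq
    simp [h2.2]
  · intro p hp
    rfl
  · intro q hq
    rfl

/-! ### Paths and cycles as sums over compositions -/

section CompSums

variable {R : Type*} [CommRing R] (e : ℕ → R)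

/-- `e_I` for an arbitrary sequence `e` in a commutative ring. -/
def listProd (I : List ℕ) : R := (I.map e).prod

theorem listProd_append (A B : List ℕ) : listProd e (A ++ B) = listProd e A * listProd e B := by
  simp [listProd]

theorem listProd_cons (i : ℕ) (B : List ℕ) : listProd e (i :: B) = e i * listProd e B := by
  simp [listProd]

theorem listProd_reverse (A : List ℕ) : listProd e A.reverse = listProd e A := by
  simp [listProd, List.prod_reverse]

variable [Algebra ℚ R]

/-- `∑ w_K e_K` over the compositions `K` of `n`. -/
noncomputable def pathComp (n : ℕ) : R := ∑ K ∈ comps n, weight K • listProd e K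

/-- `∑ (k₁ - 1) w_K e_K` over the compositions `K` of `n`. -/
noncomputable def cycleComp (n : ℕ) : R :=
  ∑ K ∈ comps n, (((K.headI : ℚ) - 1) * weight K) • listProd e K

theorem pathComp_zero : pathComp e 0 = 1 := by
  simp [pathComp, comps_zero, weight, listProd]

theorem sum_comps_last {M : Type*} [AddCommMonoid M] (n : ℕ) (hn : 0 < n) (F : List ℕ → M) :
    ∑ K ∈ comps n, F K = ∑ k ∈ Finset.range n, ∑ K ∈ comps (n - 1 - k), F (K ++ [k + 1]) := by
  rw [Finset.sum_sigma']
  symm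
  refine Finset.sum_bij (fun q _ => q.2 ++ [q.1 + 1]) ?_ ?_ ?_ ?_
  · rintro ⟨k, K⟩ h
    simp only [Finset.mem_sigma, Finset.mem_range, mem_comps] at h ⊢
    have := isComp_append h.2 (⟨by simp, by simp⟩ : IsComp [k + 1] (k + 1))
    rwa [show n - 1 - k + (k + 1) = n by omega] at this
  · rintro ⟨k, K⟩ _ ⟨k', K'⟩ _ h
    have h2 := List.append_inj' h rfl
    simp only [List.cons.injEq, Nat.add_right_cancel_iff, and_true] at h2
    obtain ⟨rfl, rfl⟩ := h2
    rfl
  · intro K hK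
    rw [mem_comps] at hK
    obtain ⟨K, k, rfl⟩ := (List.eq_nil_or_concat' K).resolve_left (hK.ne_nil hn)
    have h1 : 0 < k := hK.1 k (by simp)
    have h2 := hK.2
    simp only [List.sum_append, List.sum_cons, List.sum_nil] at h2
    refine ⟨⟨k - 1, K⟩, ?_, ?_⟩
    · simp only [Finset.mem_sigma, Finset.mem_range, mem_comps]
      exact ⟨by omega, hK.left.1, by omega⟩
    · simp [Nat.sub_add_cancel h1]
  · intro q _
    rfl

/-- Strip the last part k + 1: it contributes the factor k unless it is the only part. The one-part
composition has weight n instead of n - 1, which accounts for the extra e_n. -/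
theorem pathComp_eq (n : ℕ) (hn : 0 < n) :
    pathComp e n = e n + ∑ k ∈ Finset.range n, (k : R) * (e (k + 1) * pathComp e (n - 1 - k)) := by
  obtain ⟨n, rfl⟩ : ∃ l, n = l + 1 := ⟨n - 1, by omega⟩
  rw [pathComp, sum_comps_last _ hn, Finset.sum_range_succ, Finset.sum_range_succ]
  have h : ∀ k ∈ Finset.range n, ∑ K ∈ comps (n + 1 - 1 - k),
      weight (K ++ [k + 1]) • listProd e (K ++ [k + 1]) =
      (k : R) * (e (k + 1) * pathComp e (n + 1 - 1 - k)) := by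
    intro k hk
    rw [Finset.mem_range] at hk
    rw [pathComp, Finset.mul_sum, Finset.mul_sum]
    refine Finset.sum_congr rfl fun K hK => ?_
    have hK' : K ≠ [] := (mem_comps.mp hK).ne_nil (by omega)
    rw [weight_append _ hK', listProd_append]
    simp only [redWeight, listProd, Algebra.smul_def, List.map_cons, List.map_nil,
      List.prod_singleton, map_mul]
    push_cast
    rw [add_sub_cancel_right]
    ring
  rw [Finset.sum_congr rfl h]
  simp only [Nat.add_sub_cancel, Nat.sub_self, comps_zero, Finset.sum_singleton, List.nil_append,
    pathComp_zero, weight_cons, listProd, redWeight, List.map_nil, List.prod_nil, List.map_cons,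
    List.prod_singleton, mul_one, Algebra.smul_def, map_natCast]
  push_cast
  ring

theorem sigmaPlus_one {K : List ℕ} {n : ℕ} (h : IsComp K n) (hn : 0 < n) :
    sigmaPlus K 1 = K.headI := by
  obtain ⟨i, K, rfl⟩ := List.exists_cons_of_ne_nil (h.ne_nil hn)
  have hi : 0 < i := h.1 i (by simp)
  have := sigmaPlus_append_cons (X := []) (Y := K) (i := i) (c := 1) (by simp) (by simp; omega)
  simpa using this

/-- σ⁺ changes between c and c + 1 only if c is a partial sum. Then K = AB with |A| = c, the jump is
the first part β of B, and β w_{AB} = w_A (β - 1) w_B. -/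
theorem sum_sigmaPlus_step (n c : ℕ) (h1 : 0 < c) (h2 : c < n) :
    ∑ K ∈ comps n, (((sigmaPlus K (c + 1) : ℚ) - sigmaPlus K c) * weight K) • listProd e K =
      pathComp e c * cycleComp e (n - c) := by
  rw [pathComp, cycleComp, Finset.sum_mul_sum, ← Finset.sum_product']
  symm
  have key : ∀ A B : List ℕ, IsComp A c → IsComp B (n - c) →
      sigmaPlus (A ++ B) (c + 1) = c + B.headI ∧ sigmaPlus (A ++ B) c = c := by
    intro A B hA hB
    obtain ⟨i, B, rfl⟩ := List.exists_cons_of_ne_nil (hB.ne_nil (by omega))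
    have hi : 0 < i := hB.1 i (by simp)
    constructor
    · rw [sigmaPlus_append_cons (by rw [hA.2]; omega) (by rw [hA.2]; omega), hA.2]
      rfl
    · rw [sigmaPlus_append h1 hA.2.ge]
      have := sigmaPlus_sum (A := A) (by rw [hA.2]; exact h1)
      rwa [hA.2] at this
  refine Finset.sum_of_injOn (fun p => p.1 ++ p.2) ?_ ?_ ?_ ?_
  · rintro ⟨A, B⟩ hp ⟨A', B'⟩ hp' h
    simp only [Finset.coe_product, Set.mem_prod, Finset.mem_coe, mem_comps] at hp hp'
    obtain ⟨h3, h4⟩ := append_inj_of_sum_eq h (isComp_append hp.1 hp.2).1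
      (hp.1.2.trans hp'.1.2.symm)
    exact Prod.ext h3 h4
  · rintro ⟨A, B⟩ hp
    simp only [Finset.coe_product, Set.mem_prod, Finset.mem_coe, mem_comps] at hp ⊢
    have := isComp_append hp.1 hp.2
    rwa [show c + (n - c) = n by omega] at this
  · intro K hK hK'
    rw [mem_comps] at hK
    obtain ⟨X, i, Y, rfl, h3, h4⟩ := exists_block K c h1 (by rw [hK.2]; omega)
    have h5 : c ≠ X.sum + i := by
      rintro rfl
      refine hK' ⟨(X ++ [i], Y), ?_, by simp⟩
      rw [List.append_cons] at hK
      simp only [Finset.coe_product, Set.mem_prod, Finset.mem_coe, mem_comps]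
      have h6 : (X ++ [i]).sum = X.sum + i := by simp
      exact ⟨h6 ▸ hK.left, h6 ▸ hK.right⟩
    rw [sigmaPlus_append_cons h3 h4, sigmaPlus_append_cons (by omega) (by omega)]
    simp
  · rintro ⟨A, B⟩ hp
    simp only [Finset.mem_product, mem_comps] at hp
    obtain ⟨h3, h4⟩ := key A B hp.1 hp.2
    obtain ⟨i, B, rfl⟩ := List.exists_cons_of_ne_nil (hp.2.ne_nil (by omega))
    rw [h3, h4, weight_append _ (hp.1.ne_nil h1), listProd_append, smul_mul_smul_comm,
      weight_cons, redWeight_cons]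
    congr 1
    simp only [List.headI_cons]
    push_cast
    ring

theorem sum_sigmaPlus_sub (n c j : ℕ) (h1 : 0 < c) (h2 : c + j ≤ n) :
    ∑ K ∈ comps n, (((sigmaPlus K (c + j) : ℚ) - sigmaPlus K c) * weight K) • listProd e K =
      ∑ i ∈ Finset.range j, pathComp e (c + i) * cycleComp e (n - (c + i)) := by
  induction j with
  | zero => simp
  | succ j ih =>
    rw [Finset.sum_range_succ, ← ih (by omega),
      ← sum_sigmaPlus_step e n (c + j) (by omega) (by omega), ← Finset.sum_add_distrib]
    refine Finset.sum_congr rfl fun K _ => ?_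
    rw [← add_smul]
    congr 1
    rw [add_assoc c j 1]
    ring

theorem sum_size_sub_sigmaPlus (c j : ℕ) (h1 : 0 < c) :
    ∑ A ∈ comps (c + j), (((c + j : ℕ) - (sigmaPlus A c : ℚ)) * weight A) • listProd e A =
      ∑ i ∈ Finset.range j, pathComp e (c + i) * cycleComp e (j - i) := by
  have h := sum_sigmaPlus_sub e (c + j) c j h1 le_rfl
  simp only [Nat.add_sub_add_left] at h
  rw [← h]
  refine Finset.sum_congr rfl fun A hA => ?_
  have hA' := (mem_comps.mp hA).2
  have := sigmaPlus_sum (A := A) (by omega)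
  rw [hA'] at this
  rw [this]

/-- Take c = 1 in `sum_size_sub_sigmaPlus`, where σ⁺(1) is the first part k₁, and use k - k₁ = (k -
1) - (k₁ - 1). This is the recursion of `cycleSum_eq`. -/
theorem cycleComp_eq (k : ℕ) (hk : 0 < k) :
    cycleComp e k = ((k : R) - 1) * pathComp e k -
      ∑ j ∈ Finset.range (k - 1), pathComp e (1 + j) * cycleComp e (k - 1 - j) := by
  obtain ⟨k, rfl⟩ : ∃ l, k = l + 1 := ⟨k - 1, by omega⟩
  have h := sum_size_sub_sigmaPlus e 1 k one_pos
  rw [Nat.add_sub_cancel, ← h, cycleComp, pathComp, Finset.mul_sum, add_comm 1 k,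
    ← Finset.sum_sub_distrib]
  refine Finset.sum_congr rfl fun K hK => ?_
  rw [sigmaPlus_one (mem_comps.mp hK) hk]
  simp only [Algebra.smul_def, map_mul, map_sub, map_natCast, map_one]
  ring

variable {e}

theorem pathSum_eq_pathComp {ι : Type*} [Fintype ι] (x : ι → R) (n : ℕ) :
    pathSum x n = pathComp (finElem x) n := by
  induction n using Nat.strong_induction_on with
  | _ n ih =>
    rcases Nat.eq_zero_or_pos n with rfl | hn
    · rw [pathComp_zero, pathSum]
    · rw [pathSum_eq x n hn, pathComp_eq _ n hn]
      congr 1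
      refine Finset.sum_congr rfl fun k hk => ?_
      rw [ih _ (by omega)]

theorem cycleSum_eq_cycleComp {ι : Type*} [Fintype ι] (x : ι → R) (n : ℕ) (hn : 0 < n) :
    cycleSum x n = cycleComp (finElem x) n := by
  induction n using Nat.strong_induction_on with
  | _ n ih =>
    rw [cycleSum_eq x n hn, cycleComp_eq _ n hn, pathSum_eq_pathComp]
    congr 1
    refine Finset.sum_congr rfl fun k hk => ?_
    rw [Finset.mem_range] at hk
    rw [ih _ (by omega) (by omega), pathSum_eq_pathComp]

end CompSums

/-! ### The positive expansion as a sum over compositions -/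

theorem exists_block_of_le {L : List ℕ} {n c : ℕ} (h : IsComp L n) (h1 : 0 < c) (h2 : c ≤ n) :
    ∃ X i Y, L = X ++ i :: Y ∧ X.sum < c ∧ c ≤ X.sum + i :=
  exists_block L c h1 (by rw [h.2]; exact h2)

/-- A uniform description of the three parts of `hatSet`. -/
theorem mem_hatSet_iff {a m b : ℕ} (I J : List ℕ) :
    (I, J) ∈ hatSet a m b ↔ IsComp (I ++ J) (a + m + b) ∧ 1 ≤ I.sum ∧ I.sum + 2 ≤ m ∧
      b + m + I.headI ≤ sigmaPlus J (b + 1) + I.sum := by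
  have perm : ∀ I J₁ J₂ : List ℕ, ∀ n, IsComp (J₁ ++ I.reverse ++ J₂) n ↔
      IsComp (I ++ (J₁ ++ J₂)) n := by
    intro I J₁ J₂ n
    have h : (J₁ ++ I.reverse ++ J₂).Perm (I ++ (J₁ ++ J₂)) := by
      rw [← List.append_assoc]
      refine List.Perm.append_right _ (List.perm_append_comm.trans ?_)
      exact List.Perm.append_right _ (List.reverse_perm I)
    rw [IsComp, IsComp, h.sum_eq]
    simp only [h.mem_iff]
  have rev : ∀ (i : ℕ) (I J₁ J₂ : List ℕ), (J₁ ++ (i :: I).reverse ++ J₂).reverse =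
      J₂.reverse ++ i :: (I ++ J₁.reverse) := by
    intro i I J₁ J₂
    simp
  constructor
  -- Since |I| + |J₁| + |J₂| = a + m + b, the last inequality of the goal says |J₂| + i₁ ≤ a. In the
  -- first set this is the condition on σ⁻; in the second it follows from |J₁| ≥ b + m and i₁ ≤ |I|;
  -- in the third i₁ = 1.
  · rintro ((⟨I', J', J₁, J₂, K, hp, ⟨rfl, h1⟩, rfl, hK, h2, h3, h4, h5, h6⟩ |
      ⟨I', J', J₁, J₂, K, hp, ⟨rfl, h1⟩, rfl, hK, h2, h3, h4, h5⟩) |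
      ⟨I', J', J₁, J₂, hp, ⟨rfl, h1⟩, hK, h2, h3, h4⟩)
    all_goals
      obtain ⟨rfl, rfl⟩ := Prod.mk.inj hp
    · obtain ⟨i, I, rfl⟩ := List.exists_cons_of_ne_nil (l := I) (by rintro rfl; simp at h4)
      rw [rev] at h6
      have hi : 0 < i := hK.1 i (by simp)
      have h7 := (lt_sigmaMinus_append_cons (X := J₂.reverse) (Y := I ++ J₁.reverse) (c := a)
        hi).mp (by rw [List.sum_reverse]; omega)
      rw [perm] at hK
      have h8 := hK.2
      simp only [List.sum_append, List.sum_cons, List.sum_reverse] at h5 h7 h8 ⊢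
      refine ⟨hK, ?_, ?_, ?_⟩
      · omega
      · omega
      · rw [List.headI_cons]
        omega
    · obtain ⟨i, I, rfl⟩ := List.exists_cons_of_ne_nil (l := I) (by rintro rfl; simp at h4)
      rw [perm] at hK
      simp only [List.sum_cons] at h4 h5 ⊢
      refine ⟨hK, ?_, ?_, ?_⟩
      · omega
      · omega
      · rw [List.headI_cons]
        omega
    · obtain ⟨i, I, rfl⟩ := List.exists_cons_of_ne_nil (l := I) (by rintro rfl; simp at h2)
      simp only [List.head?_cons, Option.some.injEq] at h2
      subst h2
      have h8 := hK.2
      simp only [List.sum_append, List.sum_cons] at h3 h8 ⊢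
      refine ⟨hK, ?_, ?_, ?_⟩
      · omega
      · omega
      · rw [List.headI_cons]
        omega
  · rintro ⟨hK, h1, h2, h3⟩
    obtain ⟨i, I, rfl⟩ := List.exists_cons_of_ne_nil (l := I) (by rintro rfl; simp at h1)
    have hi : 0 < i := hK.1 i (by simp)
    obtain ⟨X, j, J₂, rfl, h4, h5⟩ := exists_block_of_le hK.right (c := b + 1) (by omega)
      (by omega)
    rw [sigmaPlus_append_cons h4 h5] at h3
    have hb : IsBisection b (X ++ j :: J₂) (X ++ [j]) J₂ :=
      ⟨by simp, by rw [sigmaPlus_append_cons h4 h5]; simp⟩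
    have h8 := hK.2
    have h9 : (X ++ [j]).sum = X.sum + j := by simp
    rw [List.headI_cons] at h3
    simp only [List.sum_append, List.sum_cons] at h1 h2 h3 h8
    by_cases h1' : i = 1
    · subst h1'
      refine Or.inr ⟨_, _, X ++ [j], J₂, rfl, hb, hK, rfl, ?_, ?_⟩
      · rw [List.sum_cons]; omega
      · omega
    · have hK' := (perm (i :: I) (X ++ [j]) J₂ (a + m + b)).mpr (by simpa using hK)
      by_cases h7 : X.sum + j ≤ b + m - 1
      · refine Or.inl (Or.inl ⟨_, _, X ++ [j], J₂, _, rfl, hb, rfl, hK', by simpa using h1', ?_,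
          ?_, ?_, ?_⟩)
        · omega
        · rw [List.sum_cons]; omega
        · rw [List.sum_cons]; omega
        · rw [rev]
          have := (lt_sigmaMinus_append_cons (X := J₂.reverse) (Y := I ++ (X ++ [j]).reverse)
            (c := a) hi).mpr (by rw [List.sum_reverse]; omega)
          rw [List.sum_reverse] at this
          omega
      · refine Or.inl (Or.inr ⟨_, _, X ++ [j], J₂, _, rfl, hb, rfl, hK', by simpa using h1', ?_,
          ?_, ?_⟩)
        · omega
        · rw [List.sum_cons]; omega
        · rw [List.sum_cons]; omega

/-- For a cut `K = A B`, the number `k - (|A| + b₁ - σ⁺_A(b+1))`. -/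
noncomputable def cutN (k b : ℕ) (p : List ℕ × List ℕ) : ℤ :=
  k - (p.1.sum + p.2.headI - sigmaPlus p.1 (b + 1))

section Expansion

variable {R : Type*} [CommRing R] [Algebra ℚ R] (e : ℕ → R)

/-- The term `w_A w_B e_{AB}`. -/
noncomputable def pairTerm (p : List ℕ × List ℕ) : R :=
  (weight p.1 * weight p.2) • listProd e (p.1 ++ p.2)

/-- Pairs `(A, B)` of compositions with total size `n` and `l ≤ |A| < l + j`. -/
noncomputable def cuts (n l j : ℕ) : Finset (List ℕ × List ℕ) :=
  {p ∈ compPairs n | l ≤ p.1.sum ∧ p.1.sum < l + j}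

theorem mem_cuts {n l j : ℕ} {A B : List ℕ} :
    (A, B) ∈ cuts n l j ↔ IsComp (A ++ B) n ∧ l ≤ A.sum ∧ A.sum < l + j := by
  simp [cuts, mem_compPairs]

/-- Write A = X i Y with i the block of cell b + 1, and B = l Z. The bijection sends (A, B) to I = l
Ȳ, where Ȳ reverses Y, and J = X i Z. It preserves w_A w_B and the product of the e's, and `cutN`
becomes k - |I|. The bound |A| ≤ b + k becomes the failure of the inequality that defines S. -/
theorem sum_cuts_complement (a k b : ℕ) :
    ∑ p ∈ cuts (a + (k + 1) + b) 1 k with ¬ (b + (k + 1) + p.1.headI ≤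
        sigmaPlus p.2 (b + 1) + p.1.sum), ((k : ℚ) - p.1.sum) • pairTerm e p =
      ∑ p ∈ cuts (a + (k + 1) + b) (b + 1) k with 0 ≤ cutN k b p,
        (cutN k b p : ℚ) • pairTerm e p := by
  have shape : ∀ (X Y Z : List ℕ) (i l : ℕ),
      IsComp (l :: Y.reverse ++ (X ++ i :: Z)) (a + (k + 1) + b) ↔
        IsComp (X ++ i :: Y ++ l :: Z) (a + (k + 1) + b) := by
    intro X Y Z i l
    have h : (l :: Y.reverse ++ (X ++ i :: Z)).Perm (X ++ i :: Y ++ l :: Z) := by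
      rw [← Multiset.coe_eq_coe]
      have hY : ((Y.reverse : List ℕ) : Multiset ℕ) = (Y : Multiset ℕ) :=
        Multiset.coe_eq_coe.mpr (List.reverse_perm Y)
      simp only [← Multiset.coe_add, ← Multiset.cons_coe, hY, ← Multiset.singleton_add]
      abel
    rw [IsComp, IsComp, h.sum_eq]
    simp only [h.mem_iff]
  symm
  refine Finset.sum_bij'
    (fun p _ => (p.2.headI :: (bisect (b + 1) p.1).2.reverse, (bisect (b + 1) p.1).1 ++ p.2.tail))
    (fun p _ => ((bisect (b + 1) p.2).1 ++ p.1.tail.reverse, p.1.headI :: (bisect (b + 1) p.2).2))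
    ?_ ?_ ?_ ?_ ?_
  case refine_1 =>
    rintro ⟨A, B⟩ hp
    simp only [Finset.mem_filter, mem_cuts] at hp ⊢
    simp only [cutN] at hp ⊢
    obtain ⟨⟨h1, h2, h3⟩, h4⟩ := hp
    obtain ⟨X, i, Y, rfl, h5, h6⟩ := exists_block A (b + 1) (by omega) h2
    obtain ⟨l, Z, rfl⟩ := List.exists_cons_of_ne_nil (h1.right.ne_nil (by omega))
    have hl : 0 < l := h1.1 l (by simp)
    have h7 : X ++ [i] ++ Z = X ++ i :: Z := by simp
    rw [sigmaPlus_append_cons h5 h6] at h4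
    simp only [bisect_append_cons h5 h6, List.headI_cons, List.tail_cons, h7,
      sigmaPlus_append_cons h5 h6]
    simp only [List.sum_append, List.sum_cons, List.sum_reverse, List.headI_cons] at h3 h4 ⊢
    exact ⟨⟨(shape X Y Z i l).mpr h1, by omega, by omega⟩, by omega⟩
  case refine_2 =>
    rintro ⟨I, J⟩ hp
    simp only [Finset.mem_filter, mem_cuts] at hp ⊢
    simp only [cutN] at hp ⊢
    obtain ⟨⟨h1, h2, h3⟩, h4⟩ := hp
    obtain ⟨l, Y, rfl⟩ := List.exists_cons_of_ne_nil (l := I) (by rintro rfl; simp at h2)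
    obtain ⟨X, i, Z, rfl, h5, h6⟩ := exists_block_of_le h1.right (c := b + 1) (by omega)
      (by omega)
    obtain ⟨Y, rfl⟩ : ∃ Y', Y = List.reverse Y' := ⟨Y.reverse, by simp⟩
    have h7 : X ++ [i] ++ Y = X ++ i :: Y := by simp
    rw [sigmaPlus_append_cons h5 h6] at h4
    simp only [bisect_append_cons h5 h6, List.headI_cons, List.tail_cons, List.reverse_reverse, h7,
      sigmaPlus_append_cons h5 h6]
    simp only [List.sum_append, List.sum_cons, List.sum_reverse, List.headI_cons] at h3 h4 ⊢
    exact ⟨⟨(shape X Y Z i l).mp h1, by omega, by omega⟩, by omega⟩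
  case refine_3 =>
    rintro ⟨A, B⟩ hp
    simp only [Finset.mem_filter, mem_cuts] at hp
    obtain ⟨⟨h1, h2, h3⟩, h4⟩ := hp
    obtain ⟨X, i, Y, rfl, h5, h6⟩ := exists_block A (b + 1) (by omega) h2
    obtain ⟨l, Z, rfl⟩ := List.exists_cons_of_ne_nil (h1.right.ne_nil (by omega))
    simp [bisect_append_cons h5 h6]
  case refine_4 =>
    rintro ⟨I, J⟩ hp
    simp only [Finset.mem_filter, mem_cuts] at hp
    obtain ⟨⟨h1, h2, h3⟩, h4⟩ := hp
    obtain ⟨l, Y, rfl⟩ := List.exists_cons_of_ne_nil (l := I) (by rintro rfl; simp at h2)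
    obtain ⟨X, i, Z, rfl, h5, h6⟩ := exists_block_of_le h1.right (c := b + 1) (by omega)
      (by omega)
    simp [bisect_append_cons h5 h6]
  case refine_5 =>
    rintro ⟨A, B⟩ hp
    simp only [Finset.mem_filter, mem_cuts] at hp
    obtain ⟨⟨h1, h2, h3⟩, h4⟩ := hp
    obtain ⟨X, i, Y, rfl, h5, h6⟩ := exists_block A (b + 1) (by omega) h2
    obtain ⟨l, Z, rfl⟩ := List.exists_cons_of_ne_nil (h1.right.ne_nil (by omega))
    have hX : X ++ [i] ≠ [] := by simp
    have hw : weight (X ++ i :: Y) * weight (l :: Z) =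
        weight (l :: Y.reverse) * weight (X ++ [i] ++ Z) := by
      rw [List.append_cons, weight_append _ hX, weight_append _ hX, weight_cons, weight_cons,
        redWeight_reverse]
      ring
    have he : listProd e (X ++ i :: Y ++ l :: Z) =
        listProd e (l :: Y.reverse ++ (X ++ [i] ++ Z)) := by
      simp only [listProd_append, listProd_cons, listProd_reverse]
      simp only [listProd, List.map_nil, List.prod_nil]
      ring
    simp only [bisect_append_cons h5 h6, List.headI_cons, List.tail_cons, pairTerm, hw, he, cutN,
      sigmaPlus_append_cons h5 h6]
    congr 1
    simp only [List.sum_append, List.sum_cons, List.sum_reverse]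
    generalize Y.sum = s
    push_cast
    ring

/-- Enlarging S to allow |I| = k is harmless, since the coefficient vanishes there. -/
theorem sum_hatPairs (a k b : ℕ) :
    ∑ p ∈ hatPairs a (k + 1) b, (((k + 1 : ℕ) : ℚ) - 1 - (p.1.sum : ℚ)) • pairTerm e p =
      ∑ p ∈ cuts (a + (k + 1) + b) 1 k with b + (k + 1) + p.1.headI ≤
        sigmaPlus p.2 (b + 1) + p.1.sum, ((k : ℚ) - p.1.sum) • pairTerm e p := by
  simp only [Nat.cast_add, Nat.cast_one, add_sub_cancel_right]
  refine Finset.sum_subset ?_ ?_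
  · rintro ⟨I, J⟩ hp
    rw [hatPairs, Set.Finite.mem_toFinset, mem_hatSet_iff] at hp
    rw [Finset.mem_filter, mem_cuts]
    exact ⟨⟨hp.1, hp.2.1, by omega⟩, hp.2.2.2⟩
  · rintro ⟨I, J⟩ hp hp'
    rw [Finset.mem_filter, mem_cuts] at hp
    rw [hatPairs, Set.Finite.mem_toFinset, mem_hatSet_iff] at hp'
    have : I.sum = k := by
      by_contra h
      exact hp' ⟨hp.1.1, hp.1.2.1, by omega, hp.2⟩
    simp [this]

/-- If `B` begins with the block of `K = A B` that contains the cell `b + k + 1`. -/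
theorem hatN_append {k b : ℕ} {A B : List ℕ} {l : ℕ} (h1 : b + 1 ≤ A.sum) (h2 : A.sum < b + 1 + k)
    (h3 : b + (k + 1) ≤ A.sum + l) : hatN (k + 1) b (A ++ l :: B) = cutN k b (A, l :: B) := by
  rw [hatN, thetaPlus, thetaPlus, cutN, sigmaPlus_append (by omega) h1,
    sigmaPlus_append_cons (by omega) h3, List.headI_cons]
  push_cast
  ring

/-- If N_K < 0, cut K = AB just before the block l of cell b + k + 1; then N_K is `cutN` of this
cut. The denominator is l - 1, and w_K = w_A (l - 1) r with r the reduced weight of the parts after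
l. The two coefficients thus add up to -N_K w_A l r = -N_K w_A w_B. -/
theorem sum_neg_hatN (a k b : ℕ) (hk : 0 < k) :
    ∑ K ∈ comps (a + (k + 1) + b) with hatN (k + 1) b K ≤ -1,
      (-(hatN (k + 1) b K : ℚ) * weight K / ((thetaPlus K (b + (k + 1)) : ℚ) +
        (thetaMinus K (b + (k + 1) - 1) : ℚ)) - (hatN (k + 1) b K : ℚ) * weight K) •
          listProd e K =
      ∑ p ∈ cuts (a + (k + 1) + b) (b + 1) k with ¬ 0 ≤ cutN k b p,
        (-(cutN k b p : ℚ)) • pairTerm e p := by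
  symm
  have shape : ∀ A B, (A, B) ∈ cuts (a + (k + 1) + b) (b + 1) k → ¬ 0 ≤ cutN k b (A, B) →
      ∃ l Z, B = l :: Z ∧ b + (k + 1) < A.sum + l := by
    intro A B hp h4
    rw [mem_cuts] at hp
    obtain ⟨h1, h2, h3⟩ := hp
    obtain ⟨l, Z, rfl⟩ := List.exists_cons_of_ne_nil (h1.right.ne_nil (by omega))
    refine ⟨l, Z, rfl, ?_⟩
    rw [cutN, List.headI_cons] at h4
    have := le_sigmaPlus (A := A) (c := b + 1) (by omega) h2
    dsimp only at h4
    omega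
  refine Finset.sum_bij (fun p _ => p.1 ++ p.2) ?_ ?_ ?_ ?_
  · rintro ⟨A, B⟩ hp
    rw [Finset.mem_filter] at hp
    obtain ⟨l, Z, rfl, h⟩ := shape A B hp.1 hp.2
    obtain ⟨h1, h2, h3⟩ := mem_cuts.mp hp.1
    rw [Finset.mem_filter, mem_comps, hatN_append h2 h3 h.le]
    exact ⟨h1, by omega⟩
  · rintro ⟨A, B⟩ hp ⟨A', B'⟩ hp' h
    rw [Finset.mem_filter] at hp hp'
    obtain ⟨l, Z, rfl, h4⟩ := shape A B hp.1 hp.2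
    obtain ⟨l', Z', rfl, h4'⟩ := shape A' B' hp'.1 hp'.2
    obtain ⟨h1, h2, h3⟩ := mem_cuts.mp hp.1
    obtain ⟨h1', h2', h3'⟩ := mem_cuts.mp hp'.1
    -- The concatenation determines the cut, since |A| is its deficiency partial sum at b + k.
    have e1 := sigmaMinus_append_cons (X := A) (Y := Z) (i := l) (c := b + k) (by omega) (by omega)
    have e2 := sigmaMinus_append_cons (X := A') (Y := Z') (i := l') (c := b + k) (by omega)
      (by omega)
    dsimp only at h
    rw [h, e2] at e1
    obtain ⟨h5, h6⟩ := append_inj_of_sum_eq h h1.1 e1.symm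
    exact Prod.ext h5 h6
  · intro K hK
    rw [Finset.mem_filter, mem_comps] at hK
    obtain ⟨hK, hN⟩ := hK
    obtain ⟨A, l, Z, rfl, h1, h2⟩ := exists_block_of_le hK (c := b + (k + 1)) (by omega) (by omega)
    have h3 : b + 1 ≤ A.sum := by
      -- If cells b + 1 and b + k + 1 lay in one block, both values of σ⁺ would agree and N_K would
      -- equal k.
      by_contra h3
      rw [hatN, thetaPlus, thetaPlus, sigmaPlus_append_cons (c := b + 1) (by omega) (by omega),
        sigmaPlus_append_cons h1 h2] at hN
      push_cast at hN
      omega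
    rw [hatN_append h3 (by omega) h2] at hN
    exact ⟨(A, l :: Z), by rw [Finset.mem_filter, mem_cuts]; exact ⟨⟨hK, h3, by omega⟩, by omega⟩,
      rfl⟩
  · rintro ⟨A, B⟩ hp
    rw [Finset.mem_filter] at hp
    obtain ⟨l, Z, rfl, h⟩ := shape A B hp.1 hp.2
    obtain ⟨h1, h2, h3⟩ := mem_cuts.mp hp.1
    dsimp only
    have hA : A ≠ [] := by rintro rfl; simp at h2
    rw [hatN_append h2 h3 h.le, thetaPlus, thetaMinus, sigmaPlus_append_cons (by omega) h.le,
      sigmaMinus_append_cons (by omega) (by omega), weight_append _ hA, pairTerm, smul_smul]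
    congr 1
    have hl : (l : ℚ) - 1 ≠ 0 := by
      have : (1 : ℚ) < l := by exact_mod_cast (by omega : 1 < l)
      linarith
    have hd : (((A.sum + l : ℕ) : ℤ) - ((b + (k + 1) : ℕ) : ℤ) : ℤ) +
        ((((b + (k + 1) - 1 : ℕ) : ℤ) - (A.sum : ℤ) : ℤ) : ℚ) = (l : ℚ) - 1 := by
      rw [show b + (k + 1) - 1 = b + k by omega]
      push_cast
      ring
    rw [hd, redWeight_cons, weight_cons]
    field_simp
    ring

/-- Split `cutN` as (k - 1) - (β - 1) - (|A| - σ⁺_A(b+1)), with β the first part of B. The three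
terms sum to path times path, path times cycle, and path times `sum_size_sub_sigmaPlus`. -/
theorem sum_cutN (a k b : ℕ) :
    ∑ p ∈ cuts (a + (k + 1) + b) (b + 1) k, (cutN k b p : ℚ) • pairTerm e p =
      ∑ j ∈ Finset.range k, (((k : R) - 1) * (pathComp e (b + 1 + j) * pathComp e (a + k - j)) -
        pathComp e (b + 1 + j) * cycleComp e (a + k - j) -
        pathComp e (a + k - j) *
          ∑ i ∈ Finset.range j, pathComp e (b + 1 + i) * cycleComp e (j - i)) := by
  rw [cuts, sum_compPairs_filter _ _ _ (by omega)]
  refine Finset.sum_congr rfl fun j hj => ?_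
  rw [Finset.mem_range] at hj
  rw [show a + (k + 1) + b - (b + 1 + j) = a + k - j by omega,
    ← sum_size_sub_sigmaPlus e (b + 1) j (by omega), mul_comm (pathComp e (a + k - j)) (∑ _ ∈ _, _)]
  simp only [pathComp, cycleComp, Finset.sum_mul_sum, Finset.mul_sum (a := ((k : R) - 1)),
    ← Finset.sum_sub_distrib]
  refine Finset.sum_congr rfl fun A hA => Finset.sum_congr rfl fun B hB => ?_
  rw [pairTerm, cutN, (mem_comps.mp hA).2, listProd_append]
  simp only [Algebra.smul_def]
  push_cast
  ring

/-- The expansion over compositions in terms of paths and cycles. -/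
theorem sum_expansion (a k b : ℕ) (hk : 0 < k) :
    (∑ K ∈ comps (a + (k + 1) + b) with hatN (k + 1) b K ≤ -1,
      (-(hatN (k + 1) b K : ℚ) * weight K / ((thetaPlus K (b + (k + 1)) : ℚ) +
        (thetaMinus K (b + (k + 1) - 1) : ℚ))) • listProd e K) +
    (∑ K ∈ comps (a + (k + 1) + b) with 1 ≤ hatN (k + 1) b K,
      ((hatN (k + 1) b K : ℚ) * weight K) • listProd e K) +
    (∑ p ∈ hatPairs a (k + 1) b, (((k + 1 : ℕ) : ℚ) - 1 - (p.1.sum : ℚ)) • pairTerm e p) =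
      (k : R) * pathComp e (a + (k + 1) + b) +
      ∑ i ∈ Finset.range k, ((k : R) - 1 - i) * (pathComp e (i + 1) * pathComp e (a + k + b - i))
      - ((k : R) - 1) * ∑ j ∈ Finset.range k, pathComp e (b + 1 + j) * pathComp e (a + k - j)
      + ∑ j ∈ Finset.range k, pathComp e (a + k - j) *
          ∑ i ∈ Finset.range j, pathComp e (b + 1 + i) * cycleComp e (j - i) := by
  have h1 := sum_neg_hatN e a k b hk
  have h2 := sum_cuts_complement e a k b
  have h3 := sum_hatPairs e a k b
  have h4 := sum_cutN e a k b
  have h5 : ∑ p ∈ cuts (a + (k + 1) + b) 1 k, ((k : ℚ) - p.1.sum) • pairTerm e p =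
      ∑ i ∈ Finset.range k, ((k : R) - 1 - i) *
        (pathComp e (i + 1) * pathComp e (a + k + b - i)) := by
    rw [cuts, sum_compPairs_filter _ _ _ (by omega)]
    refine Finset.sum_congr rfl fun i hi => ?_
    rw [show a + (k + 1) + b - (1 + i) = a + k + b - i by omega, add_comm 1 i]
    simp only [pathComp, Finset.sum_mul_sum, Finset.mul_sum (a := ((k : R) - 1 - i))]
    refine Finset.sum_congr rfl fun A hA => Finset.sum_congr rfl fun B hB => ?_
    rw [pairTerm, (mem_comps.mp hA).2, listProd_append]
    simp only [Algebra.smul_def]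
    push_cast
    ring
  have h6 : ∑ K ∈ comps (a + (k + 1) + b), ((hatN (k + 1) b K : ℚ) * weight K) • listProd e K =
      (k : R) * pathComp e (a + (k + 1) + b) -
        ∑ j ∈ Finset.range k, pathComp e (b + 1 + j) * cycleComp e (a + k - j) := by
    have h7 := sum_sigmaPlus_sub e (a + (k + 1) + b) (b + 1) k (by omega) (by omega)
    have h8 : ∀ j, a + (k + 1) + b - (b + 1 + j) = a + k - j := by omega
    simp only [h8] at h7
    rw [← h7, pathComp, Finset.mul_sum, ← Finset.sum_sub_distrib]
    refine Finset.sum_congr rfl fun K _ => ?_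
    rw [hatN, thetaPlus, thetaPlus, show b + 1 + k = b + (k + 1) by ring]
    simp only [Algebra.smul_def]
    push_cast
    ring
  have h9 : ∑ K ∈ comps (a + (k + 1) + b), ((hatN (k + 1) b K : ℚ) * weight K) • listProd e K =
      (∑ K ∈ comps (a + (k + 1) + b) with hatN (k + 1) b K ≤ -1,
        ((hatN (k + 1) b K : ℚ) * weight K) • listProd e K) +
      ∑ K ∈ comps (a + (k + 1) + b) with 1 ≤ hatN (k + 1) b K,
        ((hatN (k + 1) b K : ℚ) * weight K) • listProd e K := by
    rw [Finset.sum_filter, Finset.sum_filter, ← Finset.sum_add_distrib]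
    refine Finset.sum_congr rfl fun K _ => ?_
    rcases lt_trichotomy (hatN (k + 1) b K) 0 with h | h | h
    · rw [if_pos (by omega), if_neg (by omega), add_zero]
    · simp [h]
    · rw [if_neg (by omega), if_pos (by omega), zero_add]
  have h10 := Finset.sum_filter_add_sum_filter_not (cuts (a + (k + 1) + b) 1 k)
    (fun p => b + (k + 1) + p.1.headI ≤ sigmaPlus p.2 (b + 1) + p.1.sum)
    (fun p => ((k : ℚ) - p.1.sum) • pairTerm e p)
  have h11 := Finset.sum_filter_add_sum_filter_not (cuts (a + (k + 1) + b) (b + 1) k)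
    (fun p => 0 ≤ cutN k b p) (fun p => (cutN k b p : ℚ) • pairTerm e p)
  simp only [sub_smul, Finset.sum_sub_distrib] at h1
  simp only [neg_smul, Finset.sum_neg_distrib] at h1
  simp only [Finset.sum_sub_distrib, ← Finset.mul_sum] at h4
  rw [h3]
  -- The products of a path and a cycle in `h6` and `h4` cancel. By `h2`, so do the cuts with
  -- nonnegative `cutN` and the pairs outside S.
  linear_combination h1 + h10 + h5 - h2 + h6 - h9 - h4 - h11

end Expansion

/-! ### Restriction to finitely many variables -/

/-- Two power series have the same coefficients at all monomials in the first `N` variables. -/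
def AgreeBelow (N : ℕ) (f g : MvPowerSeries ℕ ℚ) : Prop :=
  ∀ d : ℕ →₀ ℕ, (∀ i, N ≤ i → d i = 0) → MvPowerSeries.coeff d f = MvPowerSeries.coeff d g

/-- Every factor of a monomial in the first N variables is again such a monomial. -/
theorem AgreeBelow.mul {N : ℕ} {f g f' g' : MvPowerSeries ℕ ℚ} (h : AgreeBelow N f g)
    (h' : AgreeBelow N f' g') : AgreeBelow N (f * f') (g * g') := by
  classical
  intro d hd
  rw [MvPowerSeries.coeff_mul, MvPowerSeries.coeff_mul]
  refine Finset.sum_congr rfl fun p hp => ?_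
  rw [Finset.HasAntidiagonal.mem_antidiagonal] at hp
  have hp' : ∀ i, p.1 i + p.2 i = d i := fun i => by rw [← hp]; rfl
  rw [h p.1 fun i hi => ?_, h' p.2 fun i hi => ?_]
  all_goals
    have h1 := hp' i
    have h2 := hd i hi
    omega

theorem AgreeBelow.listProd {N : ℕ} {e e' : ℕ → MvPowerSeries ℕ ℚ}
    (h : ∀ k, AgreeBelow N (e k) (e' k)) (I : List ℕ) :
    AgreeBelow N (listProd e I) (listProd e' I) := by
  induction I with
  | nil => intro d _; rfl
  | cons i I ih =>
    rw [listProd_cons, listProd_cons]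
    exact (h i).mul ih

/-- The first `N` variables. -/
noncomputable def firstVars (N : ℕ) (i : Fin N) : MvPowerSeries ℕ ℚ := MvPowerSeries.X (i : ℕ)

theorem prod_firstVars {N : ℕ} {α : Type*} (s : Finset α) (u : α → Fin N) :
    ∏ v ∈ s, firstVars N (u v) =
      MvPowerSeries.monomial (∑ v ∈ s, Finsupp.single (u v : ℕ) 1) (1 : ℚ) := by
  classical
  induction s using Finset.induction_on with
  | empty => simp [MvPowerSeries.monomial_zero_one]
  | insert v s hv ih =>
    rw [Finset.prod_insert hv, Finset.sum_insert hv, ih, firstVars, MvPowerSeries.X,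
      MvPowerSeries.monomial_mul_monomial, one_mul]

theorem sum_single_apply {N : ℕ} (s : Finset (Fin N)) (i : Fin N) :
    (∑ v ∈ s, Finsupp.single (v : ℕ) 1 : ℕ →₀ ℕ) i = if i ∈ s then 1 else 0 := by
  classical
  simp only [Finsupp.finsetSum_apply, Finsupp.single_apply, Fin.val_inj]
  simp

theorem sum_single_apply_of_le {N : ℕ} {α : Type*} (s : Finset α) (u : α → Fin N) (i : ℕ)
    (hi : N ≤ i) : (∑ v ∈ s, Finsupp.single (u v : ℕ) 1 : ℕ →₀ ℕ) i = 0 := by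
  classical
  rw [Finsupp.finsetSum_apply]
  refine Finset.sum_eq_zero fun v _ => ?_
  rw [Finsupp.single_apply, if_neg]
  have := (u v).2
  omega

theorem agreeBelow_elem (N k : ℕ) : AgreeBelow N (elem k) (finElem (firstVars N) k) := by
  classical
  intro d hd
  have hdeg : d.degree = ∑ i : Fin N, d i := by
    rw [Finsupp.degree_apply, ← Finset.sum_range (fun i => d i)]
    refine Finset.sum_subset (fun i hi => ?_) (fun i _ hi => by simpa using hi)
    rw [Finset.mem_range]
    by_contra h
    exact (Finsupp.mem_support_iff.mp hi) (hd i (by omega))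
  rw [finElem, map_sum]
  simp only [prod_firstVars _ (fun i : Fin N => i), MvPowerSeries.coeff_monomial]
  have hleft : MvPowerSeries.coeff d (elem k) = if d.degree = k ∧ ∀ i, d i ≤ 1 then 1 else 0 := rfl
  rw [hleft]
  by_cases hsq : ∀ i, d i ≤ 1
  -- A squarefree exponent is the indicator of exactly one set of variables, so at most one summand
  -- survives.
  · have hs : ∀ s : Finset (Fin N), d = (∑ v ∈ s, Finsupp.single (v : ℕ) 1 : ℕ →₀ ℕ) ↔
        s = Finset.univ.filter fun i : Fin N => d i = 1 := by
      intro s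
      constructor
      · intro h
        ext i
        rw [h, Finset.mem_filter, sum_single_apply]
        simp
      · intro h
        ext i
        rcases lt_or_ge i N with hi | hi
        · have h1 := sum_single_apply s ⟨i, hi⟩
          dsimp only at h1
          rw [h1, h]
          have := hsq i
          simp only [Finset.mem_filter, Finset.mem_univ, true_and]
          split_ifs <;> omega
        · rw [hd i hi, sum_single_apply_of_le s (fun i => i) i hi]
    simp only [hs, Finset.sum_ite_eq', Finset.mem_powersetCard_univ]
    have hcard : d.degree = (Finset.univ.filter fun i : Fin N => d i = 1).card := by
      rw [hdeg, Finset.card_filter]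
      refine Finset.sum_congr rfl fun i _ => ?_
      have := hsq i
      split_ifs <;> omega
    rw [hcard]
    simp [hsq]
  · rw [if_neg fun h => hsq h.2, eq_comm]
    refine Finset.sum_eq_zero fun s _ => if_neg ?_
    intro h
    refine hsq fun i => ?_
    rcases lt_or_ge i N with hi | hi
    · have h1 := sum_single_apply s ⟨i, hi⟩
      dsimp only at h1
      rw [h, h1]
      split_ifs <;> omega
    · rw [hd i hi]
      omega

open Classical in
theorem agreeBelow_chromaticSymm {V : Type*} [Fintype V] (G : SimpleGraph V) (N : ℕ) :
    AgreeBelow N (chromaticSymm G) (∑ u : V → Fin N,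
      if ∀ v w, G.Adj v w → u v ≠ u w then ∏ v, firstVars N (u v) else 0) := by
  intro d hd
  have h1 : ∀ u : V → Fin N, MvPowerSeries.coeff d (if ∀ v w, G.Adj v w → u v ≠ u w then
      ∏ v, firstVars N (u v) else 0) =
      if (∀ v w, G.Adj v w → u v ≠ u w) ∧ ∑ v, Finsupp.single (u v : ℕ) 1 = d then (1 : ℚ)
        else 0 := by
    intro u
    rw [prod_firstVars]
    by_cases h : ∀ v w, G.Adj v w → u v ≠ u w
    · simp only [if_pos h, MvPowerSeries.coeff_monomial, eq_comm (a := d), and_iff_right h]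
    · rw [if_neg h, if_neg fun h' => h h'.1, map_zero]
  simp only [map_sum, h1]
  rw [Finset.sum_boole]
  have hleft : MvPowerSeries.coeff d (chromaticSymm G) =
      (Nat.card {κ : G.Coloring ℕ // ∑ v, Finsupp.single (κ v) 1 = d} : ℚ) := rfl
  rw [hleft, ← Fintype.card_subtype, ← Nat.card_eq_fintype_card]
  congr 1
  -- A coloring with monomial x^d only uses colors in the support of d, so it is a word over the
  -- first N colors.
  have hlt : ∀ κ : {κ : G.Coloring ℕ // ∑ v, Finsupp.single (κ v) 1 = d}, ∀ v, κ.1 v < N := by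
    rintro ⟨κ, hκ⟩ v
    by_contra h
    have h2 := hd (κ v) (not_lt.mp h)
    rw [← hκ, Finsupp.finsetSum_apply] at h2
    have h3 := (Finset.sum_eq_zero_iff.mp h2) v (Finset.mem_univ v)
    simp at h3
  refine Nat.card_congr
    { toFun := fun κ => ⟨fun v => ⟨κ.1 v, hlt κ v⟩, ?_, κ.2⟩
      invFun := fun u => ⟨SimpleGraph.Coloring.mk (fun v => (u.1 v : ℕ)) ?_, u.2.2⟩
      left_inv := fun κ => by ext; rfl
      right_inv := fun u => by ext; rfl }
  · intro v w h h'
    exact κ.1.valid h (congrArg Fin.val h')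
  · intro v w h h'
    exact u.2.1 v w h (Fin.ext h')

/-! ### From colorings of the hat to the expansion -/

open Classical in
theorem sum_hat_words_of_eq {ι R : Type*} [Fintype ι] [CommRing R] (x : ι → R)
    (a k b n : ℕ) (hk : 0 < k) (hn : n = a + k + b + 1) :
    ∑ u : Fin n → ι, (if (∀ i (h : i + 1 < n), u ⟨i, by omega⟩ ≠ u ⟨i + 1, h⟩) ∧
          u ⟨a, by omega⟩ ≠ u ⟨a + k, by omega⟩ then ∏ i, x (u i) else 0) =
      pathSum x n - ∑ y, tailSum x a y * closedSum x k y * tailSum x b y := by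
  subst hn
  rw [← sum_hat_words x a k b hk]
  refine Finset.sum_congr rfl fun u _ => ?_
  refine if_congr (and_congr_left fun _ => ?_) rfl rfl
  exact ⟨fun h i => h i (by omega), fun h i hi => h ⟨i, by omega⟩⟩

theorem forall_hat_adj {ι : Type*} (a k b : ℕ) (hm : 2 ≤ k + 1)
    (u : Fin (a + (k + 1) + b) → ι) :
    (∀ v w, (hat a (k + 1) b hm).Adj v w → u v ≠ u w) ↔
      (∀ i (h : i + 1 < a + (k + 1) + b), u ⟨i, by omega⟩ ≠ u ⟨i + 1, h⟩) ∧
        u ⟨a, by omega⟩ ≠ u ⟨a + k, by omega⟩ := by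
  constructor
  · intro h
    refine ⟨fun i hi => h _ _ ?_, h _ _ ?_⟩
    · rw [hat, SimpleGraph.sup_adj, SimpleGraph.pathGraph_adj]
      exact Or.inl (Or.inl rfl)
    · rw [hat, SimpleGraph.sup_adj, SimpleGraph.edge_adj]
      refine Or.inr ⟨Or.inl ⟨rfl, rfl⟩, ?_⟩
      simp only [ne_eq, Fin.mk.injEq]
      omega
  · rintro ⟨h1, h2⟩ v w h
    rw [hat, SimpleGraph.sup_adj, SimpleGraph.pathGraph_adj, SimpleGraph.edge_adj] at h
    rcases h with (h | h) | ⟨⟨rfl, rfl⟩ | ⟨rfl, rfl⟩, -⟩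
    · have := h1 v (by omega)
      simpa only [h] using this
    · have := (h1 w (by omega)).symm
      simpa only [h] using this
    · exact h2
    · exact h2.symm

theorem hat_words_eq {R : Type*} [CommRing R] [Algebra ℚ R] {ι : Type*} [Fintype ι]
    (x : ι → R) (a k b : ℕ) :
    pathSum x (a + (k + 1) + b) - ∑ y, tailSum x a y * closedSum x k y * tailSum x b y =
      (k : R) * pathComp (finElem x) (a + (k + 1) + b) +
      ∑ i ∈ Finset.range k, ((k : R) - 1 - i) *
        (pathComp (finElem x) (i + 1) * pathComp (finElem x) (a + k + b - i))
      - ((k : R) - 1) * ∑ j ∈ Finset.range k,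
        pathComp (finElem x) (b + 1 + j) * pathComp (finElem x) (a + k - j)
      + ∑ j ∈ Finset.range k, pathComp (finElem x) (a + k - j) *
          ∑ i ∈ Finset.range j,
            pathComp (finElem x) (b + 1 + i) * cycleComp (finElem x) (j - i) := by
  have h1 : ∀ j, ∑ i ∈ Finset.range j,
      pathComp (finElem x) (b + 1 + i) * cycleComp (finElem x) (j - i) = pathCycleSum x b j := by
    intro j
    rw [pathCycleSum]
    refine Finset.sum_congr rfl fun i hi => ?_
    rw [Finset.mem_range] at hi
    rw [pathSum_eq_pathComp, cycleSum_eq_cycleComp _ _ (by omega)]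
  simp only [h1]
  rw [sum_tailSum_closedSum_tailSum]
  simp only [pathSum_eq_pathComp]
  rw [show a + k + b + 1 = a + (k + 1) + b by ring]
  ring

theorem thetaPlus_nonneg {K : List ℕ} {c : ℕ} (h1 : 0 < c) (h2 : c ≤ K.sum) :
    0 ≤ thetaPlus K c := by
  have := le_sigmaPlus h1 h2
  rw [thetaPlus]
  omega

theorem thetaMinus_nonneg (K : List ℕ) (c : ℕ) : 0 ≤ thetaMinus K c := by
  have : sigmaMinus K c ≤ c :=
    csSup_le ⟨0, 0, by simp, by simp, by simp⟩ (by rintro s ⟨k, -, -, hs⟩; exact hs)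
  rw [thetaMinus]
  omega

theorem chromaticSymm_hat (a k b : ℕ) (hm : 2 ≤ k + 1) :
    chromaticSymm (hat a (k + 1) b hm) =
      (∑ K ∈ comps (a + (k + 1) + b) with hatN (k + 1) b K ≤ -1,
        (-(hatN (k + 1) b K : ℚ) * weight K / ((thetaPlus K (b + (k + 1)) : ℚ) +
          (thetaMinus K (b + (k + 1) - 1) : ℚ))) • listProd elem K) +
      (∑ K ∈ comps (a + (k + 1) + b) with 1 ≤ hatN (k + 1) b K,
        ((hatN (k + 1) b K : ℚ) * weight K) • listProd elem K) +
      (∑ p ∈ hatPairs a (k + 1) b, (((k + 1 : ℕ) : ℚ) - 1 - (p.1.sum : ℚ)) • pairTerm elem p) := by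
  classical
  refine MvPowerSeries.ext fun d => ?_
  -- N exceeds every variable occurring in x^d, so this coefficient is already visible in the first
  -- N variables.
  set N := d.support.sup id + 1
  have hd : ∀ i, N ≤ i → d i = 0 := by
    intro i hi
    by_contra h
    have : i ≤ d.support.sup id :=
      Finset.le_sup (f := id) (Finsupp.mem_support_iff.mpr h)
    omega
  have hL : ∀ I, MvPowerSeries.coeff d (listProd elem I) =
      MvPowerSeries.coeff d (listProd (finElem (firstVars N)) I) :=
    fun I => AgreeBelow.listProd (agreeBelow_elem N) I d hd
  have h1 := agreeBelow_chromaticSymm (hat a (k + 1) b hm) N d hd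
  simp only [forall_hat_adj] at h1
  have h2 := (sum_hat_words_of_eq (firstVars N) a k b _ (by omega)
    (show a + (k + 1) + b = a + k + b + 1 by ring)).trans ((hat_words_eq (firstVars N) a k b).trans
      (sum_expansion (finElem (firstVars N)) a k b (by omega)).symm)
  have h3 := h1.trans ((congrArg (MvPowerSeries.coeff d) (by convert rfl)).trans
    (congrArg (MvPowerSeries.coeff d) h2))
  rw [h3]
  simp only [pairTerm, map_add, map_sum, map_smul, hL]

end ChromaticHat

theorem mainTheorem2 (a m b : ℕ) (hm : 2 ≤ m) :
    chromaticSymm (hat a m b hm) =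
        (∑ K : Composition (a + m + b) with hatN m b K.blocks ≤ -1,
          (-(hatN m b K.blocks : ℚ) * weight K.blocks /
            ((thetaPlus K.blocks (b + m) : ℚ) + (thetaMinus K.blocks (b + m - 1) : ℚ))) •
              elemComp K.blocks)
        + (∑ K : Composition (a + m + b) with 1 ≤ hatN m b K.blocks,
          ((hatN m b K.blocks : ℚ) * weight K.blocks) • elemComp K.blocks)
        + (∑ p ∈ hatPairs a m b,
          (((m : ℚ) - 1 - (p.1.sum : ℚ)) * weight p.1 * weight p.2) • elemComp (p.1 ++ p.2))
    -- all the coefficients of this expansion are nonnegative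
    ∧ (∀ K : Composition (a + m + b), hatN m b K.blocks ≤ -1 →
        0 ≤ -(hatN m b K.blocks : ℚ) * weight K.blocks /
            ((thetaPlus K.blocks (b + m) : ℚ) + (thetaMinus K.blocks (b + m - 1) : ℚ)))
    ∧ (∀ K : Composition (a + m + b), 1 ≤ hatN m b K.blocks →
        0 ≤ (hatN m b K.blocks : ℚ) * weight K.blocks)
    ∧ (∀ p ∈ hatPairs a m b,
        0 ≤ ((m : ℚ) - 1 - (p.1.sum : ℚ)) * weight p.1 * weight p.2) := by
  obtain ⟨k, rfl⟩ : ∃ k, m = k + 1 := ⟨m - 1, by omega⟩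
  have hw : ∀ K : Composition (a + (k + 1) + b), 0 ≤ weight K.blocks :=
    fun K => weight_nonneg fun i hi => K.blocks_pos hi
  refine ⟨?_, ?_, ?_, ?_⟩
  · rw [chromaticSymm_hat]
    simp only [Finset.sum_filter]
    rw [← sum_composition, ← sum_composition]
    simp only [pairTerm, smul_smul, ← mul_assoc]
    rfl
  · intro K hK
    refine div_nonneg (mul_nonneg ?_ (hw K)) (add_nonneg ?_ ?_)
    · have : (hatN (k + 1) b K.blocks : ℚ) ≤ -1 := by exact_mod_cast hK
      linarith
    · exact_mod_cast thetaPlus_nonneg (by omega) (by rw [K.blocks_sum]; omega)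
    · exact_mod_cast thetaMinus_nonneg _ _
  · intro K hK
    have : (1 : ℚ) ≤ hatN (k + 1) b K.blocks := by exact_mod_cast hK
    exact mul_nonneg (by linarith) (hw K)
  · rintro ⟨I, J⟩ hp
    rw [hatPairs, Set.Finite.mem_toFinset, mem_hatSet_iff] at hp
    obtain ⟨h1, h2, h3, -⟩ := hp
    have h4 : (I.sum : ℚ) + 2 ≤ ((k + 1 : ℕ) : ℚ) := by exact_mod_cast h3
    refine mul_nonneg (mul_nonneg ?_ (weight_nonneg h1.left.1)) (weight_nonneg h1.right.1)
    dsimp only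
    linarith
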